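/- Let $K$ be an algebraically closed field of characteristic $0$, and let $n,r,s,\delta,w$ be integers with $1\le\delta<n$, $2\le r<s$ and $0\le w\le r-1$. Order monomials in $x_1,\dots,x_n$ lexicographically with $x_1>\dots>x_n$; let $\mathbb T^n_\delta$ be the set of monomials in $x_\delta,\dots,x_n$, and put $b_\ell=x_\delta^{r-w}x_n^w$. **Order ideal.** Let $\mathcal O=\bigcup_{d=0}^s\mathcal O_d$, where $\mathcal O_d$ is the set of all monomials of degree $d$ if $d<r$, and $\mathcal O_d=\{m\in\mathbb T^n_\delta:\deg m=d,\ m<x_n^{d-r}b_\ell\}$ if $r\le d\le s$. Let $\mu=|\mathcal O|$, let $\partial\mathcal O=(x_1\mathcal O\cup\dots\cup x_n\mathcal O)\setminus\mathcal O$, $LM=\{m:\deg m=r,\ m\ge b_\ell\}$, $TM=\mathcal O_s$, $\mathrm{Tar}'=\bigcup_{d=r}^{s-1}\mathcal O_d$, $\mathrm{Tar}''=\{m\in\mathrm{Tar}':x_{\delta+1}^w\mid m\}$, $\mathcal S_L=LM\cap\mathbb T^n_\delta$ and $\mathcal S_D=\{m\in\partial\mathcal O\cap\mathbb T^n_\delta: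 r+1\le\deg m\le s\}$. **Indeterminates.** Let $D=\{C_{t,b}: t\in TM,\ b\in LM\}$ and $\Theta=\{\theta_t: t\in\mathrm{Tar}''\}$. Let $\Delta_\alpha=\{m\in\mathbb T^n_\delta: m=1 \text{ or } m\,x_n^{r-1}\in\mathrm{Tar}'\}$ for $\alpha<\delta$ and $\Delta_\alpha=\{1\}$ for $\alpha\ge\delta$, and let $\mathcal Z=\{Z_{\alpha,m}:1\le\alpha\le n,\ m\in\Delta_\alpha\}$. **Generic modification.** For $0\le e\le w$ put $b_e=x_\delta^{r-e}x_{\delta+1}^e$. Define $\Upsilon(b)\in K[\Theta][x_1,\dots,x_n]$ for $b\in\partial\mathcal O$ as follows. (1) $\Upsilon(b_w)=\sum_{t\in\mathrm{Tar}''}\theta_t\,t$. (2) For $b\in\mathcal S_D$, $\Upsilon(b)$ is $\frac{b}{b_w}\Upsilon(b_w)$ with all terms of degree $>s$ deleted. (3) For $e=w,w-1,\dots,1$, $\Upsilon(b_{e-1})=\mathrm{red}(x_\delta\Upsilon(b_e))/x_{\delta+1}$, where $\mathrm{red}$ is linear, fixes the monomials in $\mathcal O$, and replaces each monomial $b\in\mathcal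 S_D$ by $-\Upsilon(b)$. (4) If $b\in\mathcal S_L$ has $x_\delta$-degree $r-e$, then $\Upsilon(b)=\frac{b}{b_e}\Upsilon(b_e)$. (5) $\Upsilon(b)=0$ for all other $b\in\partial\mathcal O$. (All the divisions are exact.) For $b\in\partial\mathcal O$ put $\hat G_b=b-\sum_{t\in TM}C_{t,b}\,t+\Upsilon(b)$, where the sum is present only if $b\in LM$. The ideals $I_{(c,d)}\subseteq K[x_1,\dots,x_n]$ generated by the specializations of the $\hat G_b$ at $C\mapsto c$, $\theta\mapsto d$ are the mod-distinguished ideals. **The map $\mathcal F$.** Let $A=K[D,\Theta,\mathcal Z]$, $U=\operatorname{Spec}A$, and let $T^*_{\mathcal Z}$ be the automorphism of the $A$-algebra $A[x_1,\dots,x_n]$ with $x_\alpha\mapsto x_\alpha+\sum_{m\in\Delta_\alpha}Z_{\alpha,m}\,m$ for all $\alpha$. Let $J$ be the ideal of $A[x_1,\dots,x_n]$ generated by the polynomials $T^*_{\mathcal Z}(\hat G_b)$, $b\in\partial\mathcal O$. **Proposition.** The quotient $A[x_1,\dots,x_n]/J$ is a finitely generated projective $A$-module of constant rank $\mu$, so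 $J$ defines a morphism $\mathcal F:U\to\operatorname{Hilb}^\mu_{\mathbb A^n_K}$. Let $p=(c,d,z)$ be a $K$-point of $U$ with $z=0$ (so that $p$ corresponds to the mod-distinguished ideal $I_{(c,d)}$). For $\chi\in D\cup\Theta\cup\mathcal Z$ let $w_{p,\chi}\in\mathcal T_{\mathcal F(p)}$ be the image under the derivative $\mathcal F'_p:\mathcal T_p\to\mathcal T_{\mathcal F(p)}$ of the coordinate tangent vector in the direction $\chi$, i.e. the $K[\epsilon]$-point of $\operatorname{Hilb}^\mu_{\mathbb A^n_K}$ obtained from $\mathcal F$ by specializing $\chi\mapsto\chi(p)+\epsilon$ and $\varrho\mapsto\varrho(p)$ for $\varrho\ne\chi$. Then the family $(w_{p,\chi})_{\chi\in D\cup\Theta\cup\mathcal Z}$ is $K$-linearly independent; equivalently, $\mathcal F'_p$ is injective. -/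

import Mathlib

noncomputable section HilbertFunctor

open TensorProduct TrivSqZeroExt

/-- The ideal `J` of `A[x₁, …, xₙ]` is an `A`-valued point of the Hilbert scheme of `μ` points of
affine `n`-space: the quotient is a finitely generated projective `A`-module of constant rank `μ`
(that is, finite locally free of rank `μ` over `Spec A`). -/
def IsHilbPoint (n μ : ℕ) (A : Type*) [CommRing A] (J : Ideal (MvPolynomial (Fin n) A)) : Prop :=
  Module.Finite A (MvPolynomial (Fin n) A ⧸ J) ∧
  Module.Projective A (MvPolynomial (Fin n) A ⧸ J) ∧
  ∀ P : PrimeSpectrum A, Module.rankAtStalk (R := A) (MvPolynomial (Fin n) A ⧸ J) P = μ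

attribute [local instance] MvPolynomial.algebraMvPolynomial in
/-- Points of the Hilbert scheme are stable under base change. -/
theorem IsHilbPoint.map {n μ : ℕ} {A B : Type*} [CommRing A] [CommRing B] (f : A →+* B)
    {J : Ideal (MvPolynomial (Fin n) A)} (hJ : IsHilbPoint n μ A J) :
    IsHilbPoint n μ B (J.map (MvPolynomial.map f)) := by
  let _ := f.toAlgebra
  obtain ⟨h1, h2, h3⟩ := hJ
  let e1 := (Algebra.TensorProduct.quotIdealMapEquivTensorQuot
    (MvPolynomial (Fin n) B) J).toLinearEquiv.restrictScalars B
  let e2 := Algebra.IsPushout.cancelBaseChange A B (MvPolynomial (Fin n) A)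
    (MvPolynomial (Fin n) B) (MvPolynomial (Fin n) A ⧸ J)
  let e := e1.trans e2
  have hmap : algebraMap (MvPolynomial (Fin n) A) (MvPolynomial (Fin n) B) = MvPolynomial.map f :=
    rfl
  rw [← hmap]
  refine ⟨Module.Finite.equiv e.symm, Module.Projective.of_equiv e.symm, fun P => ?_⟩
  rw [Module.rankAtStalk_eq_of_equiv e, Module.rankAtStalk_baseChange, h3]

/-- The set `Hilb^μ(𝔸ⁿ)(A)` of `A`-valued points of the Hilbert scheme; equivalently, the set of
morphisms `Spec A ⟶ Hilb^μ(𝔸ⁿ)`. -/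
@[ext]
structure HilbPoint (n μ : ℕ) (A : Type*) [CommRing A] where
  ideal : Ideal (MvPolynomial (Fin n) A)
  isHilbPoint : IsHilbPoint n μ A ideal

namespace HilbPoint

variable {n μ : ℕ} {A B C : Type*} [CommRing A] [CommRing B] [CommRing C]

/-- Functoriality of the Hilbert functor: composition of `Spec A ⟶ Hilb` with `Spec B ⟶ Spec A`. -/
def map (f : A →+* B) (x : HilbPoint n μ A) : HilbPoint n μ B :=
  ⟨x.ideal.map (MvPolynomial.map f), x.isHilbPoint.map f⟩

theorem map_map (f : A →+* B) (g : B →+* C) (x : HilbPoint n μ A) :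
    (x.map f).map g = x.map (g.comp f) := by
  ext1
  simp only [map, Ideal.map_map]
  congr 1
  ext <;> simp

variable {k : Type*} [Field k]

/-- The reduction `k[ε] → k`, `ε ↦ 0`. -/
def epsZero (k : Type*) [Field k] : DualNumber k →+* k := (fstHom k k k).toRingHom

/-- The tangent space of the Hilbert scheme at the `k`-point `x`: the `k[ε]`-valued points that
reduce to `x` modulo `ε`. -/
@[ext]
structure Tangent (x : HilbPoint n μ k) where
  point : HilbPoint n μ (DualNumber k)
  spec : point.map (epsZero k) = x

/-- The identification of `k[ε][x]` with the dual numbers over `k[x]`. -/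
def split (n : ℕ) (k : Type*) [Field k] :
    MvPolynomial (Fin n) (DualNumber k) →+* DualNumber (MvPolynomial (Fin n) k) :=
  MvPolynomial.eval₂Hom
    (DualNumber.lift ⟨((inlAlgHom k (MvPolynomial (Fin n) k) (MvPolynomial (Fin n) k)).comp
      (Algebra.ofId k _), DualNumber.eps), by simp, by
        intro r; exact mul_comm _ _⟩).toRingHom
    (fun i => inl (MvPolynomial.X i))

/-- `f + ε g` -/
def join (f g : MvPolynomial (Fin n) k) : MvPolynomial (Fin n) (DualNumber k) :=
  MvPolynomial.map (inlHom k k) f + MvPolynomial.C DualNumber.eps * MvPolynomial.map (inlHom k k) g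

theorem split_map (f : MvPolynomial (Fin n) k) :
    split n k (MvPolynomial.map (inlHom k k) f) = inl f := by
  induction f using MvPolynomial.induction_on with
  | C a => simp [split]; rfl
  | add p q hp hq => simp [hp, hq]
  | mul_X p i hp => simp [hp]; simp [split]

theorem split_eps : split n k (MvPolynomial.C DualNumber.eps) = DualNumber.eps := by
  simp [split]

theorem split_join (f g : MvPolynomial (Fin n) k) : split n k (join f g) = inl f + inr g := by
  simp [join, split_map, split_eps]
  ext <;> simp


theorem join_add (f g f' g' : MvPolynomial (Fin n) k) :
    join f g + join f' g' = join (f + f') (g + g') := by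
  simp only [join, _root_.map_add]; ring

theorem map_mul_join (a f g : MvPolynomial (Fin n) k) :
    MvPolynomial.map (inlHom k k) a * join f g = join (a * f) (a * g) := by
  simp only [join, map_mul]; ring

theorem coeff_join (f g : MvPolynomial (Fin n) k) (m : Fin n →₀ ℕ) :
    (join f g).coeff m = inl (f.coeff m) + inr (g.coeff m) := by
  simp only [join, MvPolynomial.coeff_add, MvPolynomial.coeff_map, MvPolynomial.coeff_C_mul]
  ext <;> simp

theorem join_split (F : MvPolynomial (Fin n) (DualNumber k)) :
    join (split n k F).fst (split n k F).snd = F := by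
  induction F using MvPolynomial.induction_on with
  | C a =>
    have h : (MvPolynomial.C a : MvPolynomial (Fin n) (DualNumber k)) =
        join (MvPolynomial.C a.fst) (MvPolynomial.C a.snd) := by
      simp only [join, MvPolynomial.map_C, ← map_mul, ← _root_.map_add]
      congr 1
      ext <;> simp
    rw [h, split_join]
    simp
  | add p q hp hq =>
    rw [_root_.map_add, fst_add, snd_add, ← join_add, hp, hq]
  | mul_X p i hp =>
    have h : p * MvPolynomial.X i = join (MvPolynomial.X i * (split n k p).fst)
        (MvPolynomial.X i * (split n k p).snd) := by
      rw [← map_mul_join, hp, MvPolynomial.map_X, mul_comm]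
    rw [h, split_join]
    simp

theorem coeff_split_fst (F : MvPolynomial (Fin n) (DualNumber k)) (m : Fin n →₀ ℕ) :
    (split n k F).fst.coeff m = (F.coeff m).fst := by
  conv_rhs => rw [← join_split F, coeff_join]
  simp

theorem coeff_split_snd (F : MvPolynomial (Fin n) (DualNumber k)) (m : Fin n →₀ ℕ) :
    (split n k F).snd.coeff m = (F.coeff m).snd := by
  conv_rhs => rw [← join_split F, coeff_join]
  simp

theorem map_epsZero (F : MvPolynomial (Fin n) (DualNumber k)) :
    MvPolynomial.map (epsZero k) F = (split n k F).fst := by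
  ext m
  rw [coeff_split_fst, MvPolynomial.coeff_map]
  rfl

theorem map_epsZero_join (f g : MvPolynomial (Fin n) k) :
    MvPolynomial.map (epsZero k) (join f g) = f := by
  rw [map_epsZero, split_join]; simp

theorem map_epsZero_surjective :
    Function.Surjective (MvPolynomial.map (σ := Fin n) (epsZero k)) :=
  fun f => ⟨join f 0, map_epsZero_join f 0⟩

/-- The first-order deformation `{f + ε g | f ∈ I, φ f = g mod I}` of an ideal `I` along a
homomorphism `φ : I → k[x]/I`. -/
def deform (I : Ideal (MvPolynomial (Fin n) k))
    (φ : I →ₗ[MvPolynomial (Fin n) k] MvPolynomial (Fin n) k ⧸ I) :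
    Ideal (MvPolynomial (Fin n) (DualNumber k)) where
  carrier := {F | ∃ h : (split n k F).fst ∈ I,
    φ ⟨(split n k F).fst, h⟩ = Ideal.Quotient.mk I (split n k F).snd}
  zero_mem' := ⟨by simp, by
    have : (⟨(split n k 0).fst, by simp⟩ : I) = 0 := by ext; simp
    rw [this]; simp⟩
  add_mem' := by
    rintro F G ⟨h, e⟩ ⟨h', e'⟩
    refine ⟨by simpa using I.add_mem h h', ?_⟩
    have : (⟨(split n k (F + G)).fst, by simpa using I.add_mem h h'⟩ : I) =
      ⟨_, h⟩ + ⟨_, h'⟩ := by ext; simp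
    rw [this, LinearMap.map_add, e, e']; simp
  smul_mem' := by
    rintro G F ⟨h, e⟩
    have h1 : (split n k (G • F)).fst ∈ I := by
      simpa using I.mul_mem_left _ h
    refine ⟨h1, ?_⟩
    have : (⟨(split n k (G • F)).fst, h1⟩ : I) = (split n k G).fst • ⟨_, h⟩ := by ext; simp
    rw [this, LinearMap.map_smul, e]
    have h2 : Ideal.Quotient.mk I (split n k F).fst = 0 := Ideal.Quotient.eq_zero_iff_mem.2 h
    simp [h2]
    rfl

theorem join_mem_deform {I : Ideal (MvPolynomial (Fin n) k)}
    {φ : I →ₗ[MvPolynomial (Fin n) k] MvPolynomial (Fin n) k ⧸ I} {f g : MvPolynomial (Fin n) k} :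
    join f g ∈ deform I φ ↔ ∃ h : f ∈ I, φ ⟨f, h⟩ = Ideal.Quotient.mk I g := by
  change (∃ h : (split n k (join f g)).fst ∈ I, φ ⟨(split n k (join f g)).fst, h⟩ =
    Ideal.Quotient.mk I (split n k (join f g)).snd) ↔ _
  simp [split_join]

theorem map_deform (I : Ideal (MvPolynomial (Fin n) k))
    (φ : I →ₗ[MvPolynomial (Fin n) k] MvPolynomial (Fin n) k ⧸ I) :
    (deform I φ).map (MvPolynomial.map (epsZero k)) = I := by
  ext f
  rw [Ideal.mem_map_iff_of_surjective _ map_epsZero_surjective]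
  constructor
  · rintro ⟨F, ⟨h, -⟩, rfl⟩
    rwa [map_epsZero]
  · intro hf
    obtain ⟨g, hg⟩ := Ideal.Quotient.mk_surjective (φ ⟨f, hf⟩)
    exact ⟨join f g, join_mem_deform.2 ⟨hf, hg.symm⟩, map_epsZero_join f g⟩

theorem isHilbPoint_deform {I : Ideal (MvPolynomial (Fin n) k)} (hI : IsHilbPoint n μ k I)
    (φ : I →ₗ[MvPolynomial (Fin n) k] MvPolynomial (Fin n) k ⧸ I) :
    IsHilbPoint n μ (DualNumber k) (deform I φ) := by
  obtain ⟨h1, -, h3⟩ := hI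
  have hfr : Module.finrank k (MvPolynomial (Fin n) k ⧸ I) = μ := by
    have := h3 ⊥
    rwa [Module.rankAtStalk_eq_finrank_of_free] at this
  let b : Module.Basis (Fin μ) k (MvPolynomial (Fin n) k ⧸ I) := Module.finBasisOfFinrankEq _ _ hfr
  choose B hB using fun i => Ideal.Quotient.mk_surjective (b i)
  have hcomb : ∀ c : Fin μ → k, Ideal.Quotient.mk I (∑ i, MvPolynomial.C (c i) * B i) =
      ∑ i, c i • b i := by
    intro c
    rw [_root_.map_sum]
    refine Finset.sum_congr rfl fun i _ => ?_
    rw [map_mul, hB]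
    exact (Algebra.smul_def (c i) (b i)).symm
  let S : (Fin μ → DualNumber k) → MvPolynomial (Fin n) (DualNumber k) := fun c =>
    join (∑ i, MvPolynomial.C (c i).fst * B i) (∑ i, MvPolynomial.C (c i).snd * B i)
  have hS : ∀ c, S c = ∑ i, c i • MvPolynomial.map (inlHom k k) (B i) := by
    intro c
    ext1 m
    simp only [S, coeff_join, MvPolynomial.coeff_sum, MvPolynomial.coeff_smul,
      MvPolynomial.coeff_map, MvPolynomial.coeff_C_mul]
    ext <;> simp [fst_sum, snd_sum, mul_comm]
  let L : (Fin μ → DualNumber k) →ₗ[DualNumber k]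
      MvPolynomial (Fin n) (DualNumber k) ⧸ deform I φ :=
    Fintype.linearCombination (DualNumber k)
      (fun i => Ideal.Quotient.mk (deform I φ) (MvPolynomial.map (inlHom k k) (B i)))
  have hL : ∀ c, L c = Ideal.Quotient.mk (deform I φ) (S c) := by
    intro c
    rw [hS, _root_.map_sum, Fintype.linearCombination_apply]
    rfl
  have hinj : Function.Injective L := by
    rw [← LinearMap.ker_eq_bot, LinearMap.ker_eq_bot']
    intro c hc
    rw [hL, Ideal.Quotient.eq_zero_iff_mem, join_mem_deform] at hc
    obtain ⟨h, e⟩ := hc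
    have hli := Fintype.linearIndependent_iff.1 b.linearIndependent
    have h0 := hli (fun i => (c i).fst) (by
      rw [← hcomb]; exact Ideal.Quotient.eq_zero_iff_mem.2 h)
    have hz : (⟨_, h⟩ : I) = 0 := by ext1; simp [h0]
    rw [hz, LinearMap.map_zero] at e
    have h1 := hli (fun i => (c i).snd) (by rw [← hcomb]; exact e.symm)
    ext i
    · exact h0 i
    · exact h1 i
  have hsurj : Function.Surjective L := by
    intro q
    obtain ⟨F, rfl⟩ := Ideal.Quotient.mk_surjective q
    rw [← join_split F]
    generalize (split n k F).fst = f
    generalize (split n k F).snd = g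
    have key : ∀ f : MvPolynomial (Fin n) k, ∃ c : Fin μ → k,
        f - ∑ i, MvPolynomial.C (c i) * B i ∈ I := fun f => by
      refine ⟨b.repr (Ideal.Quotient.mk I f), ?_⟩
      rw [← Ideal.Quotient.eq_zero_iff_mem, _root_.map_sub, hcomb, b.sum_repr, sub_self]
    obtain ⟨a, ha⟩ := key f
    obtain ⟨h', hh'⟩ := Ideal.Quotient.mk_surjective (φ ⟨_, ha⟩)
    obtain ⟨a', ha'⟩ := key (g - h')
    refine ⟨fun i => inl (a i) + inr (a' i), ?_⟩
    rw [hL, eq_comm, ← sub_eq_zero, ← _root_.map_sub, Ideal.Quotient.eq_zero_iff_mem]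
    have : join f g - S (fun i => inl (a i) + inr (a' i)) =
        join (f - ∑ i, MvPolynomial.C (a i) * B i)
          (g - ∑ i, MvPolynomial.C (a' i) * B i) := by
      rw [sub_eq_iff_eq_add, join_add]
      simp
    rw [this, join_mem_deform]
    refine ⟨ha, ?_⟩
    rw [← hh', eq_comm, ← sub_eq_zero, ← _root_.map_sub, Ideal.Quotient.eq_zero_iff_mem]
    convert ha' using 1
    ring
  let e := LinearEquiv.ofBijective L ⟨hinj, hsurj⟩
  refine ⟨Module.Finite.equiv e, Module.Projective.of_equiv e, fun P => ?_⟩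
  rw [← Module.rankAtStalk_eq_of_equiv e, Module.rankAtStalk_eq_finrank_of_free]
  simp

/-- In a projective module over `k[ε]`, the elements killed by `ε` are the multiples of `ε`. -/
theorem exists_eps_smul {M : Type*} [AddCommGroup M] [Module (DualNumber k) M]
    [Module.Projective (DualNumber k) M] {m : M} (hm : (DualNumber.eps : DualNumber k) • m = 0) :
    ∃ m', m = (DualNumber.eps : DualNumber k) • m' := by
  obtain ⟨s, hs⟩ := Module.projective_def'.1 ‹Module.Projective (DualNumber k) M›
  have h1 : (DualNumber.eps : DualNumber k) • s m = 0 := by rw [← LinearMap.map_smul, hm, map_zero]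
  refine ⟨Finsupp.linearCombination (DualNumber k) id
    ((s m).mapRange (fun c => inl c.snd) (by simp)), ?_⟩
  rw [← LinearMap.map_smul]
  conv_lhs => rw [← LinearMap.id_apply (R := DualNumber k) m, ← hs, LinearMap.comp_apply]
  congr 1
  ext x
  · simpa using congrArg (fun c => (c x).snd) h1
  · simp only [Finsupp.smul_apply, smul_eq_mul, DualNumber.snd_mul]
    simp
    rfl

theorem mem_of_eps_mul_mem {J : Ideal (MvPolynomial (Fin n) (DualNumber k))}
    (hJ : IsHilbPoint n μ (DualNumber k) J) {g : MvPolynomial (Fin n) k} (hg : join 0 g ∈ J) :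
    g ∈ J.map (MvPolynomial.map (epsZero k)) := by
  have := hJ.2.1
  have h0 : (DualNumber.eps : DualNumber k) • Ideal.Quotient.mk J (join g 0) = 0 := by
    rw [← Ideal.Quotient.eq_zero_iff_mem] at hg
    rw [← hg]
    change Ideal.Quotient.mk J (_ • _) = _
    congr 1
    ext m <;> simp [coeff_join]
  obtain ⟨m', hm'⟩ := exists_eps_smul h0
  obtain ⟨G, rfl⟩ := Ideal.Quotient.mk_surjective m'
  have h1 : join g 0 - (DualNumber.eps : DualNumber k) • G ∈ J := by
    rw [← Ideal.Quotient.eq_zero_iff_mem, _root_.map_sub, hm', sub_eq_zero]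
    rfl
  have h2 := Ideal.mem_map_of_mem (MvPolynomial.map (epsZero k)) h1
  rw [_root_.map_sub, map_epsZero_join] at h2
  convert h2 using 1
  rw [MvPolynomial.smul_eq_C_mul, map_mul, MvPolynomial.map_C]
  simp [epsZero]

theorem Tangent.exists_join_mem {x : HilbPoint n μ k} (y : Tangent x) (f : x.ideal) :
    ∃ g, join f.1 g ∈ y.point.ideal := by
  obtain ⟨f, hf⟩ := f
  have hy : y.point.ideal.map (MvPolynomial.map (epsZero k)) = x.ideal :=
    congrArg HilbPoint.ideal y.spec
  rw [← hy, Ideal.mem_map_iff_of_surjective _ map_epsZero_surjective] at hf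
  obtain ⟨F, hF, rfl⟩ := hf
  exact ⟨(split n k F).snd, by
    change join (MvPolynomial.map (epsZero k) F) _ ∈ _
    rwa [map_epsZero, join_split]⟩

theorem Tangent.mk_eq {x : HilbPoint n μ k} (y : Tangent x) {f g g' : MvPolynomial (Fin n) k}
    (h : join f g ∈ y.point.ideal) (h' : join f g' ∈ y.point.ideal) :
    Ideal.Quotient.mk x.ideal g = Ideal.Quotient.mk x.ideal g' := by
  have hy : y.point.ideal.map (MvPolynomial.map (epsZero k)) = x.ideal :=
    congrArg HilbPoint.ideal y.spec
  rw [← sub_eq_zero, ← _root_.map_sub, Ideal.Quotient.eq_zero_iff_mem, ← hy]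
  refine mem_of_eps_mul_mem y.point.isHilbPoint ?_
  have : join 0 (g - g') = join f g - join f g' := by
    rw [eq_sub_iff_add_eq, join_add]; simp
  rw [this]
  exact y.point.ideal.sub_mem h h'

/-- The homomorphism `I → k[x]/I` of a tangent vector at `[I]`: `f ↦ g mod I` whenever `f + ε g`
lies in the deformed ideal. -/
def Tangent.toHom {x : HilbPoint n μ k} (y : Tangent x) :
    x.ideal →ₗ[MvPolynomial (Fin n) k] MvPolynomial (Fin n) k ⧸ x.ideal where
  toFun f := Ideal.Quotient.mk x.ideal (y.exists_join_mem f).choose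
  map_add' f f' := by
    rw [← _root_.map_add]
    refine y.mk_eq (y.exists_join_mem (f + f')).choose_spec ?_
    have := y.point.ideal.add_mem (y.exists_join_mem f).choose_spec (y.exists_join_mem f').choose_spec
    rwa [join_add] at this
  map_smul' a f := by
    refine (y.mk_eq (y.exists_join_mem (a • f)).choose_spec
      (g' := a * (y.exists_join_mem f).choose) ?_).trans ?_
    · have := y.point.ideal.mul_mem_left (MvPolynomial.map (inlHom k k) a)
        (y.exists_join_mem f).choose_spec
      rwa [map_mul_join] at this
    · rfl

theorem Tangent.toHom_eq_iff {x : HilbPoint n μ k} (y : Tangent x) (f : x.ideal)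
    (g : MvPolynomial (Fin n) k) :
    y.toHom f = Ideal.Quotient.mk x.ideal g ↔ join f.1 g ∈ y.point.ideal := by
  constructor
  · intro h
    have h1 := (y.exists_join_mem f).choose_spec
    have h2 : (y.exists_join_mem f).choose - g ∈ x.ideal := by
      rw [← Ideal.Quotient.eq_zero_iff_mem, _root_.map_sub, sub_eq_zero]; exact h
    obtain ⟨g', hg'⟩ := y.exists_join_mem ⟨_, h2⟩
    have h3 := y.point.ideal.mul_mem_left (MvPolynomial.C DualNumber.eps) hg'
    have h4 := y.point.ideal.sub_mem h1 h3
    convert h4 using 1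
    ext m <;> simp [coeff_join, MvPolynomial.coeff_C_mul]
  · intro h
    exact y.mk_eq (y.exists_join_mem f).choose_spec h

/-- A tangent vector at `[I]` is the same as a homomorphism `I → k[x]/I`. -/
def tangentEquiv (x : HilbPoint n μ k) :
    Tangent x ≃ (x.ideal →ₗ[MvPolynomial (Fin n) k] MvPolynomial (Fin n) k ⧸ x.ideal) where
  toFun y := y.toHom
  invFun φ := ⟨⟨deform x.ideal φ, isHilbPoint_deform x.isHilbPoint φ⟩, by
    ext1; exact map_deform x.ideal φ⟩
  left_inv y := by
    apply Tangent.ext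
    apply HilbPoint.ext
    ext F
    change F ∈ deform x.ideal y.toHom ↔ _
    rw [← join_split F, join_mem_deform]
    constructor
    · rintro ⟨h, e⟩
      exact (y.toHom_eq_iff ⟨_, h⟩ _).1 e
    · intro h
      have hy : y.point.ideal.map (MvPolynomial.map (epsZero k)) = x.ideal :=
        congrArg HilbPoint.ideal y.spec
      have h' := Ideal.mem_map_of_mem (MvPolynomial.map (epsZero k)) h
      rw [map_epsZero_join, hy] at h'
      exact ⟨h', (y.toHom_eq_iff ⟨_, h'⟩ _).2 h⟩
  right_inv φ := by
    ext f
    obtain ⟨g, hg⟩ := Ideal.Quotient.mk_surjective (φ f)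
    rw [← hg]
    refine (Tangent.toHom_eq_iff _ f g).2 ?_
    exact join_mem_deform.2 ⟨f.2, hg.symm⟩

/-- The vector space structure of the tangent space at `[I]`; it is the one for which the
identification of the tangent space with `Hom(I, k[x]/I)` is linear. -/
instance (x : HilbPoint n μ k) : AddCommGroup (Tangent x) := (tangentEquiv x).addCommGroup

instance (x : HilbPoint n μ k) : Module k (Tangent x) := (tangentEquiv x).module k

theorem Tangent.toHom_add {x : HilbPoint n μ k} (y y' : Tangent x) :
    (y + y').toHom = y.toHom + y'.toHom :=
  (tangentEquiv x).apply_symm_apply _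

theorem Tangent.toHom_smul {x : HilbPoint n μ k} (c : k) (y : Tangent x) :
    (c • y).toHom = c • y.toHom :=
  (tangentEquiv x).apply_symm_apply _

theorem Tangent.toHom_injective {x : HilbPoint n μ k} :
    Function.Injective (Tangent.toHom (x := x)) := (tangentEquiv x).injective

variable {ι : Type*}

/-- The `k[ε]`-point `p + ε v` of the affine space `Spec k[ι]`, that is, the vector `v` tangent to
affine space at `p`. -/
def tangentPoint (p v : ι → k) : MvPolynomial ι k →+* DualNumber k :=
  MvPolynomial.eval₂Hom (inlHom k k) (fun i => inl (p i) + inr (v i))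

theorem epsZero_comp_tangentPoint (p v : ι → k) :
    (epsZero k).comp (tangentPoint p v) = MvPolynomial.eval p := by
  ext i
  · simp [epsZero, tangentPoint]
  · simp [epsZero, tangentPoint]


theorem map_eq_join_of_mem {A : Type*} [CommRing A] (a : A →+* k) (b : A →+* DualNumber k)
    (hab : (epsZero k).comp b = a) (G : MvPolynomial (Fin n) A) :
    MvPolynomial.map b G = join (MvPolynomial.map a G) (split n k (MvPolynomial.map b G)).snd := by
  conv_lhs => rw [← join_split (MvPolynomial.map b G)]
  rw [← map_epsZero, MvPolynomial.map_map, hab]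

/-- The image `Spec k[ε] ⟶ Spec k[ι] ⟶ Hilb` under the derivative at `p` of the morphism
`F : Spec k[ι] ⟶ Hilb` of the tangent vector `v`. -/
def tangentFun (F : HilbPoint n μ (MvPolynomial ι k)) (p v : ι → k) :
    Tangent (F.map (MvPolynomial.eval p)) :=
  ⟨F.map (tangentPoint p v), by rw [map_map, epsZero_comp_tangentPoint]⟩

theorem tangentFun_add (F : HilbPoint n μ (MvPolynomial ι k)) (p v v' : ι → k) :
    tangentFun F p (v + v') = tangentFun F p v + tangentFun F p v' := by
  apply Tangent.toHom_injective
  rw [Tangent.toHom_add]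
  ext f
  let q : MvPolynomial ι k →+* TrivSqZeroExt k (k × k) :=
    MvPolynomial.eval₂Hom (inlHom k (k × k)) (fun i => inl (p i) + inr (v i, v' i))
  let z : TrivSqZeroExt k (k × k) →+* k := (fstHom k k (k × k)).toRingHom
  let h : (k × k →ₗ[k] k) → (TrivSqZeroExt k (k × k) →+* DualNumber k) := fun l =>
    (TrivSqZeroExt.map l).toRingHom
  have hz : z.comp q = MvPolynomial.eval p := by
    ext i <;> simp [z, q]
  have h1 : (h (LinearMap.fst k k k)).comp q = tangentPoint p v := by
    ext i <;> simp [h, q, tangentPoint]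
  have h2 : (h (LinearMap.snd k k k)).comp q = tangentPoint p v' := by
    ext i <;> simp [h, q, tangentPoint]
  have h3 : (h (LinearMap.fst k k k + LinearMap.snd k k k)).comp q = tangentPoint p (v + v') := by
    ext i <;> simp [h, q, tangentPoint]
  have hzl : ∀ l, (epsZero k).comp (h l) = z := by
    intro l
    ext x
    simp [epsZero, h, z]
  have hsurj : Function.Surjective (MvPolynomial.map (σ := Fin n) z) :=
    MvPolynomial.map_surjective _ fun c => ⟨inl c, by simp [z]⟩
  obtain ⟨f, hf⟩ := f
  have hf' : f ∈ ((F.map q).map z).ideal := by rw [map_map, hz]; exact hf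
  obtain ⟨G, hG, rfl⟩ := (Ideal.mem_map_iff_of_surjective _ hsurj).1 hf'
  let g : (k × k →ₗ[k] k) → MvPolynomial (Fin n) k := fun l =>
    (split n k (MvPolynomial.map (h l) G)).snd
  have hmem : ∀ (l) (u : ι → k) (hu : (h l).comp q = tangentPoint p u),
      (tangentFun F p u).toHom ⟨_, hf⟩ = Ideal.Quotient.mk _ (g l) := by
    intro l u hu
    rw [Tangent.toHom_eq_iff]
    change join (MvPolynomial.map z G) (g l) ∈ (F.map (tangentPoint p u)).ideal
    rw [← map_eq_join_of_mem z (h l) (hzl l), ← hu, ← map_map]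
    exact Ideal.mem_map_of_mem _ hG
  rw [LinearMap.add_apply, hmem _ _ h1, hmem _ _ h2, hmem _ _ h3, ← _root_.map_add]
  congr 1
  ext m
  simp [g, coeff_split_snd, MvPolynomial.coeff_map, h]

theorem tangentFun_smul (F : HilbPoint n μ (MvPolynomial ι k)) (p : ι → k) (c : k) (v : ι → k) :
    tangentFun F p (c • v) = c • tangentFun F p v := by
  apply Tangent.toHom_injective
  rw [Tangent.toHom_smul]
  ext f
  let h : DualNumber k →+* DualNumber k :=
    (TrivSqZeroExt.map (c • (LinearMap.id : k →ₗ[k] k))).toRingHom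
  have h1 : h.comp (tangentPoint p v) = tangentPoint p (c • v) := by
    ext i <;> simp [h, tangentPoint, mul_comm]
  obtain ⟨g, hg⟩ := Ideal.Quotient.mk_surjective ((tangentFun F p v).toHom f)
  rw [LinearMap.smul_apply, ← hg]
  have hg' := (Tangent.toHom_eq_iff _ _ _).1 hg.symm
  have h2 : (tangentFun F p (c • v)).toHom f = Ideal.Quotient.mk _ (MvPolynomial.C c * g) := by
    rw [Tangent.toHom_eq_iff]
    change _ ∈ (F.map (tangentPoint p (c • v))).ideal
    rw [← h1, ← map_map]
    have := Ideal.mem_map_of_mem (MvPolynomial.map h) hg'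
    have e : join f.1 (MvPolynomial.C c * g) = MvPolynomial.map h (join f.1 g) := by
      ext m
      · simp [coeff_join, MvPolynomial.coeff_map, h, MvPolynomial.coeff_C_mul]
      · simp [coeff_join, MvPolynomial.coeff_map, h, MvPolynomial.coeff_C_mul]
        ring
    rw [e]
    exact this
  rw [h2, map_mul]
  exact (Algebra.smul_def c (Ideal.Quotient.mk (F.map (MvPolynomial.eval p)).ideal g)).symm

/-- The derivative `F'_p` of the morphism `F : Spec k[ι] ⟶ Hilb` at the `k`-point `p`, from the
tangent space `k^ι` of affine space at `p` to the tangent space of the Hilbert scheme at `F(p)`. -/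
def tangentMap (F : HilbPoint n μ (MvPolynomial ι k)) (p : ι → k) :
    (ι → k) →ₗ[k] Tangent (F.map (MvPolynomial.eval p)) where
  toFun := tangentFun F p
  map_add' := tangentFun_add F p
  map_smul' := tangentFun_smul F p

open scoped Classical in
/-- The image under `F'_p` of the tangent vector at `p` in the direction of the coordinate `χ`,
that is, the tangent vector defined by the `k[ε]`-point `χ ↦ p_χ + ε`, `ϱ ↦ p_ϱ` for `ϱ ≠ χ`. -/
def coordTangent (F : HilbPoint n μ (MvPolynomial ι k)) (p : ι → k) (χ : ι) :
    Tangent (F.map (MvPolynomial.eval p)) :=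
  tangentMap F p (Pi.single χ 1)

end HilbPoint

end HilbertFunctor

noncomputable section Distinguished

open scoped Classical

/-- A signature `(n, r, s, δ, w)`. The variables `x₁, …, xₙ` are indexed by `Fin n` (so that
`x_{i+1}` is the variable with index `i`); `δ` is the index of the middle variable, the variables
of smaller index are the front variables and those of larger index are the back variables. There
is at least one back variable. -/
structure Signature where
  n : ℕ
  r : ℕ
  s : ℕ
  δ : Fin n
  w : ℕ
  two_le_r : 2 ≤ r
  r_lt_s : r < s
  w_lt_r : w < r
  δ_lt : (δ : ℕ) + 1 < n

namespace Signature

variable (σ : Signature)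

/-- Monomials in `x₁, …, xₙ`, as exponent vectors. -/
abbrev Mon := Fin σ.n →₀ ℕ

/-- The index of `x_{δ+1}`. -/
def next : Fin σ.n := ⟨σ.δ + 1, σ.δ_lt⟩

/-- The index of `xₙ`. -/
def last : Fin σ.n := ⟨σ.n - 1, Nat.sub_lt (Nat.zero_lt_of_lt σ.δ_lt) Nat.one_pos⟩

/-- The monomials of degree `d`. -/
def mons (d : ℕ) : Finset σ.Mon := Finset.finsuppAntidiag Finset.univ d

/-- The monomial involves no front variable. -/
def NoFront (m : σ.Mon) : Prop := ∀ i < σ.δ, m i = 0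

/-- The monomial `x_n^{d-r} b_ℓ = x_δ^{r-w} x_n^{w+d-r}` for `d ≥ r`. -/
def lexBound (d : ℕ) : σ.Mon :=
  Finsupp.single σ.δ (σ.r - σ.w) + Finsupp.single σ.last (σ.w + (d - σ.r))

/-- The basis monomials of degree `d`. The order `toLex` on exponent vectors is the lexicographic
order with `x₁ > x₂ > ⋯ > xₙ`. -/
def basisMons (d : ℕ) : Finset σ.Mon :=
  if d < σ.r then σ.mons d
  else if d ≤ σ.s then
    (σ.mons d).filter fun m => σ.NoFront m ∧ toLex m < toLex (σ.lexBound d)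
  else ∅

/-- The order ideal of basis monomials. -/
def orderIdeal : Finset σ.Mon := (Finset.range (σ.s + 1)).biUnion σ.basisMons

/-- The border of the order ideal: the boundary monomials. -/
def border : Set σ.Mon :=
  {b | b ∉ σ.orderIdeal ∧ ∃ t ∈ σ.orderIdeal, ∃ i, b = t + Finsupp.single i 1}

/-- The leading monomials. -/
def leadMons : Finset σ.Mon := (σ.mons σ.r).filter fun m => toLex (σ.lexBound σ.r) ≤ toLex m

/-- The trailing monomials. -/
def trailMons : Finset σ.Mon := σ.basisMons σ.s

/-- The basis monomials of degrees `r, …, s - 1`. -/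
def tar' : Finset σ.Mon := (Finset.Ico σ.r σ.s).biUnion σ.basisMons

/-- The monomials of `tar'` that are divisible by `x_{δ+1}^w`. -/
def tar'' : Finset σ.Mon := σ.tar'.filter fun m => σ.w ≤ m σ.next

/-- The boundary monomials of degree `r` without front variables. -/
def InSL (b : σ.Mon) : Prop := b ∈ σ.leadMons ∧ σ.NoFront b

/-- The boundary monomials of degrees `r + 1, …, s` without front variables. -/
def InSD (b : σ.Mon) : Prop :=
  b ∈ σ.border ∧ σ.NoFront b ∧ σ.r + 1 ≤ b.degree ∧ b.degree ≤ σ.s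

/-- The monomials `m` used in the automorphisms `x_α ↦ x_α + z m`. (The bound `s` on the degree is
automatic; it makes the set visibly finite.) -/
def shiftMons (α : Fin σ.n) : Finset σ.Mon :=
  if α < σ.δ then
    ((Finset.range (σ.s + 1)).biUnion σ.mons).filter fun m => σ.NoFront m ∧
      (m + Finsupp.single σ.last (σ.r - 1) = Finsupp.single σ.last (σ.r - 1) ∨
        m + Finsupp.single σ.last (σ.r - 1) ∈ σ.tar')
  else {0}

/-- The distinguished indeterminates `C_{ij}`, one for each leading and trailing monomial. -/
abbrev DIdx := {b // b ∈ σ.leadMons} × {t // t ∈ σ.trailMons}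

/-- The indeterminates `θ_q`. -/
abbrev ΘIdx := {m // m ∈ σ.tar''}

/-- The indeterminates `Z_{α,λ}`. -/
abbrev ZIdx := Σ α : Fin σ.n, {m // m ∈ σ.shiftMons α}

/-- All the indeterminates, i.e. the coordinates of the affine space `U`. -/
abbrev Idx := σ.DIdx ⊕ σ.ΘIdx ⊕ σ.ZIdx

variable {R : Type*} [CommRing R]

/-- The linear extension to polynomials of a map defined on monomials. -/
def onMons (φ : σ.Mon → MvPolynomial (Fin σ.n) R) :
    MvPolynomial (Fin σ.n) R →ₗ[R] MvPolynomial (Fin σ.n) R :=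
  (MvPolynomial.basisMonomials (Fin σ.n) R).constr R φ

/-- The lex-maximal monomial `b_{j_e} = x_δ^{r-e} x_{δ+1}^e` of the segment of monomials
of degree `r` in `x_δ, …, xₙ` with `x_δ`-degree `r - e`. -/
def segTop (e : ℕ) : σ.Mon :=
  Finsupp.single σ.δ (σ.r - e) + Finsupp.single σ.next e

/-- The polynomial `(b / b_{j_e}) · P`. (It is only applied when all the divisions are exact.) -/
def transport (e : ℕ) (b : σ.Mon) (P : MvPolynomial (Fin σ.n) R) : MvPolynomial (Fin σ.n) R :=
  (MvPolynomial.monomial b 1 * P).divMonomial (σ.segTop e)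

/-- The initial target `Υ(b_{j_w}) = ∑ θ_q t_{i_q}`. -/
def initTarget (θ : σ.ΘIdx → R) : MvPolynomial (Fin σ.n) R :=
  ∑ q : σ.ΘIdx, MvPolynomial.monomial q.1 (θ q)

/-- The target of a monomial `b = m' b'` of `𝒮_D`, with `b'` in the segment of `b_{j_w}`: the
polynomial `m' Υ(b') = (b / b_{j_w}) Υ(b_{j_w})` with its terms of degree `> s` removed. -/
def targetD (θ : σ.ΘIdx → R) (b : σ.Mon) : MvPolynomial (Fin σ.n) R :=
  σ.onMons (fun m => if m.degree ≤ σ.s then MvPolynomial.monomial m 1 else 0)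
    (σ.transport σ.w b (σ.initTarget θ))

/-- Reduction: basis monomials are kept, and each `b` in `𝒮_D` is replaced by `-Υ(b)`. -/
def red (θ : σ.ΘIdx → R) : MvPolynomial (Fin σ.n) R →ₗ[R] MvPolynomial (Fin σ.n) R :=
  σ.onMons fun m =>
    if m ∈ σ.orderIdeal then MvPolynomial.monomial m 1
    else if σ.InSD m then -σ.targetD θ m
    else 0

/-- `topTarget θ i` is the target `Υ(b_{j_{w-i}})`, defined by the recursion
`Υ(b_{j_{e-1}}) = red(x_δ Υ(b_{j_e})) / x_{δ+1}`. -/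
def topTarget (θ : σ.ΘIdx → R) : ℕ → MvPolynomial (Fin σ.n) R
  | 0 => σ.initTarget θ
  | i + 1 => (σ.red θ (MvPolynomial.X σ.δ * topTarget θ i)).divMonomial (Finsupp.single σ.next 1)

/-- The target assignment `Υ`. In degree `r`, the monomial `b` lies in the segment of `b_{j_e}`
with `e = r - deg_δ(b)`, and its target is `(b / b_{j_e}) Υ(b_{j_e})`. -/
def target (θ : σ.ΘIdx → R) (b : σ.Mon) : MvPolynomial (Fin σ.n) R :=
  if σ.InSD b then σ.targetD θ b
  else if σ.InSL b then
    σ.transport (σ.r - b σ.δ) b (σ.topTarget θ (σ.w - (σ.r - b σ.δ)))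
  else 0

/-- The modified border pre-basis element
`Ĝ_b = b - ∑ c_{t,b} t + Υ(b)`, the sum (over trailing `t`) occurring for leading `b` only. -/
def modGen (c : σ.DIdx → R) (θ : σ.ΘIdx → R) (b : σ.Mon) : MvPolynomial (Fin σ.n) R :=
  MvPolynomial.monomial b 1
    - (if h : b ∈ σ.leadMons then
        ∑ t : {t // t ∈ σ.trailMons}, MvPolynomial.monomial t.1 (c (⟨b, h⟩, t))
      else 0)
    + σ.target θ b

/-- The mod-distinguished ideal with parameters `c` and `θ`. -/
def modIdeal (c : σ.DIdx → R) (θ : σ.ΘIdx → R) : Ideal (MvPolynomial (Fin σ.n) R) :=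
  Ideal.span (σ.modGen c θ '' σ.border)

/-- The automorphism `T_z^*`, i.e. the composition `T*_{1,1} ∘ T*_{1,2} ∘ ⋯ ∘ T*_{n,1}` of the
automorphisms `T*_{α,λ}` : `x_α ↦ x_α + z_{α,λ} m_{α,λ}` (fixing the other variables). Since the `m_{α,λ}`
involve no front variable and equal `1` for `α ≥ δ`, the composition sends each `x_α` to
`x_α + ∑_λ z_{α,λ} m_{α,λ}`. -/
def translate (z : σ.ZIdx → R) : MvPolynomial (Fin σ.n) R →ₐ[R] MvPolynomial (Fin σ.n) R :=
  MvPolynomial.aeval fun α =>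
    MvPolynomial.X α + ∑ m : {m // m ∈ σ.shiftMons α}, MvPolynomial.monomial m.1 (z ⟨α, m⟩)

/-- The ideal `T_Z^*(Ĝ)` over the coordinate ring of the affine space `U`, where `C`, `θ`, `Z` are
the coordinate functions; it is the family of ideals that defines the morphism `F : U ⟶ Hilb^μ`. -/
def universalIdeal (k : Type*) [Field k] :
    Ideal (MvPolynomial (Fin σ.n) (MvPolynomial σ.Idx k)) :=
  (σ.modIdeal (fun i => MvPolynomial.X (Sum.inl i))
    (fun q => MvPolynomial.X (Sum.inr (Sum.inl q)))).map
    (σ.translate fun ζ => MvPolynomial.X (Sum.inr (Sum.inr ζ)))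

end Signature

end Distinguished

/-! Write f = x_δ^{r-w} + U, where U is Υ(b_w) divided by x_{δ+1}^w. The monomials of U have no
front variable, x_δ-degree below r-w, and total degree at least r-w. So f is monic in x_δ, and
division by f and the front variables gives a linear map `rem` whose kernel is an ideal and which
never lowers the order of a polynomial. The recursion for Υ is this division in disguise: Υ(b) is
minus the remainder of b, truncated above degree s on 𝒮_D and above degree s-1 on 𝒮_L
(`target_of_inSD`, `target_of_inSL`).

Flatness: let `normalForm` fix monomials of degree below r, send a leading b to ∑ C_{t,b} t - Υ(b),
and truncate the remainder above degree s otherwise. On monomials of degree at least r it differs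
from `rem` only in order at least s. After multiplication by a variable this error lies beyond the
truncation, so the C are unconstrained and the kernel is an ideal (`normalForm_X_mul`). That kernel
is the mod-distinguished ideal (`mem_modIdeal_iff`), so over any base ring the quotient is free on
𝒪. The substitution T*_Z is triangular, hence an automorphism, and preserves this.

Injectivity: if (u, τ, ζ) is in the kernel of the derivative at a point with z = 0, then the
first-order variation of every generator lies in the ideal I (`genDer_mem_of_tangentMap_eq_zero`).
This variation is Υ'(b) - ∑ u_{t,b} t + D(Ĝ_b), with D the vector field x_α ↦ ∑ ζ_{α,m} m. An
element of I supported on 𝒪 is zero, and I has order at least r; a few border monomials then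
suffice. The monomial x_α^{s+1} kills ζ_α for back α, x_δ^r kills ζ_δ, and x_n^{r-1} x_α kills the
front shifts, because there the shift part has degree below s and the trailing part degree s. The
same degree separation at b_w gives τ = 0, and then u = 0 is read off each leading monomial.
Characteristic zero enters through the factors s+1 and r. -/

noncomputable section

open scoped Classical
open MvPolynomial TrivSqZeroExt

/-! ### Linear maps on polynomials with prescribed support -/

section Support

variable {ι R M : Type*} [CommRing R] [AddCommGroup M] [Module R M]

theorem map_mem_of_mem_restrictSupport {S : Set (ι →₀ ℕ)} {W : Submodule R M}
    (φ : MvPolynomial ι R →ₗ[R] M) (h : ∀ m ∈ S, φ (monomial m 1) ∈ W) {p : MvPolynomial ι R}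
    (hp : p ∈ restrictSupport R S) : φ p ∈ W := by
  rw [restrictSupport_eq_span] at hp
  have : Submodule.span R ((monomial · (1 : R)) '' S) ≤ W.comap φ := by
    rw [Submodule.span_le]
    rintro _ ⟨m, hm, rfl⟩
    exact h m hm
  exact this hp

theorem map_eq_of_mem_restrictSupport {S : Set (ι →₀ ℕ)}
    (φ ψ : MvPolynomial ι R →ₗ[R] M) (h : ∀ m ∈ S, φ (monomial m 1) = ψ (monomial m 1))
    {p : MvPolynomial ι R} (hp : p ∈ restrictSupport R S) : φ p = ψ p := by
  have := map_mem_of_mem_restrictSupport (W := ⊥) (φ - ψ)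
    (fun m hm => by simp [h m hm]) hp
  simpa [sub_eq_zero] using this

theorem map_eq_of_monomial (φ ψ : MvPolynomial ι R →ₗ[R] M)
    (h : ∀ m, φ (monomial m 1) = ψ (monomial m 1)) (p : MvPolynomial ι R) : φ p = ψ p :=
  map_eq_of_mem_restrictSupport (S := Set.univ) φ ψ (fun m _ => h m)
    (by rw [restrictSupport_univ]; trivial)

theorem monomial_mul_mem_restrictSupport {S T : Set (ι →₀ ℕ)} {a : ι →₀ ℕ} (c : R)
    (h : ∀ m ∈ S, a + m ∈ T) {p : MvPolynomial ι R} (hp : p ∈ restrictSupport R S) :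
    monomial a c * p ∈ restrictSupport R T :=
  map_mem_of_mem_restrictSupport (LinearMap.mulLeft R (monomial a c)) (fun m hm => by
    rw [LinearMap.mulLeft_apply, monomial_mul]
    exact (monomial_mem_restrictSupport R).2 (Or.inl (h m hm))) hp

theorem X_mul_mem_restrictSupport {S T : Set (ι →₀ ℕ)} {i : ι}
    (h : ∀ m ∈ S, Finsupp.single i 1 + m ∈ T) {p : MvPolynomial ι R}
    (hp : p ∈ restrictSupport R S) : X i * p ∈ restrictSupport R T :=
  monomial_mul_mem_restrictSupport 1 h hp

theorem coeff_eq_zero_of_mem_restrictSupport {S : Set (ι →₀ ℕ)} {p : MvPolynomial ι R}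
    (hp : p ∈ restrictSupport R S) {m : ι →₀ ℕ} (hm : m ∉ S) : p.coeff m = 0 := by
  by_contra h
  exact hm (hp (mem_support_iff.2 h))

theorem mem_restrictSupport_of_coeff {S : Set (ι →₀ ℕ)} {p : MvPolynomial ι R}
    (h : ∀ m, m ∉ S → p.coeff m = 0) : p ∈ restrictSupport R S := by
  intro m hm
  by_contra hS
  exact (mem_support_iff.1 hm) (h m hS)

end Support

namespace Signature

variable (σ : Signature)

/-! ### Combinatorics of the order ideal and its border -/

section Monomials

/-- The monomial involves no front variable and its degree in the middle variable is less than
`r - w`. -/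
def Low (m : σ.Mon) : Prop := σ.NoFront m ∧ m σ.δ < σ.r - σ.w

variable {σ}

theorem noFront_add {a b : σ.Mon} : σ.NoFront (a + b) ↔ σ.NoFront a ∧ σ.NoFront b := by
  simp only [NoFront, Finsupp.add_apply, Nat.add_eq_zero_iff]
  exact ⟨fun h => ⟨fun i hi => (h i hi).1, fun i hi => (h i hi).2⟩,
    fun h i hi => ⟨h.1 i hi, h.2 i hi⟩⟩

theorem noFront_single {i : Fin σ.n} (hi : σ.δ ≤ i) (a : ℕ) :
    σ.NoFront (Finsupp.single i a) := fun j hj => by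
  rw [Finsupp.single_apply, if_neg (hj.trans_le hi).ne']

theorem not_noFront_single {i : Fin σ.n} (hi : i < σ.δ) {a : ℕ} (ha : a ≠ 0) :
    ¬ σ.NoFront (Finsupp.single i a) := fun h => ha (by simpa using h i hi)

theorem noFront_erase {m : σ.Mon} (h : σ.NoFront m) : σ.NoFront (m.erase σ.δ) := fun i hi => by
  rw [Finsupp.erase_ne hi.ne, h i hi]

theorem δ_lt_next : σ.δ < σ.next := Fin.lt_def.2 (Nat.lt_succ_self _)

theorem δ_lt_last : σ.δ < σ.last := Fin.lt_def.2 (by have := σ.δ_lt; simp [last]; omega)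

theorem le_last (i : Fin σ.n) : i ≤ σ.last := Fin.le_def.2 (by simp [last]; omega)

theorem one_le_sub : 1 ≤ σ.r - σ.w := by have := σ.w_lt_r; omega

theorem mem_mons {d : ℕ} {m : σ.Mon} : m ∈ σ.mons d ↔ m.degree = d := by
  simp [mons, Finset.mem_finsuppAntidiag, Finsupp.degree_eq_sum]

theorem erase_add_single (m : σ.Mon) : m.erase σ.δ + Finsupp.single σ.δ (m σ.δ) = m :=
  Finsupp.erase_add_single _ _

theorem degree_erase (m : σ.Mon) : (m.erase σ.δ).degree + m σ.δ = m.degree := by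
  conv_rhs => rw [← erase_add_single m, map_add, Finsupp.degree_single]

theorem apply_le_degree (m : σ.Mon) (i : Fin σ.n) : m i ≤ m.degree := Finsupp.le_degree i m

theorem lexBound_δ (d : ℕ) : σ.lexBound d σ.δ = σ.r - σ.w := by
  simp [lexBound, δ_lt_last.ne']

theorem degree_lexBound {d : ℕ} (h : σ.r ≤ d) : (σ.lexBound d).degree = d := by
  have := σ.w_lt_r
  simp only [lexBound, map_add, Finsupp.degree_single]
  omega

theorem lexBound_of_ne {d : ℕ} {i : Fin σ.n} (h : i ≠ σ.δ) (h' : i ≠ σ.last) :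
    σ.lexBound d i = 0 := by
  simp [lexBound, h.symm, h'.symm]

/-- Replaces the lexicographic condition by one on exponents. The bound is supported on x_δ and x_n,
so a first drop can only occur at x_δ or x_n, and a first drop at x_n would make the degrees
unequal. -/
theorem lt_lexBound_iff {d : ℕ} (hd : σ.r ≤ d) {m : σ.Mon} (hm : m.degree = d) :
    toLex m < toLex (σ.lexBound d) ↔ σ.Low m := by
  rw [Finsupp.Lex.lt_iff]
  simp only [ofLex_toLex]
  constructor
  · rintro ⟨j, h1, h2⟩
    rcases lt_trichotomy j σ.δ with h | h | h
    · rw [lexBound_of_ne h.ne (h.trans δ_lt_last).ne] at h2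
      omega
    · subst h
      rw [lexBound_δ] at h2
      exact ⟨fun i hi => by rw [h1 i hi, lexBound_of_ne hi.ne (hi.trans δ_lt_last).ne], h2⟩
    · by_cases hj : j = σ.last
      · exfalso
        subst hj
        have h3 : m.degree < (σ.lexBound d).degree := by
          rw [Finsupp.degree_eq_sum, Finsupp.degree_eq_sum]
          refine Finset.sum_lt_sum (fun i _ => ?_) ⟨_, Finset.mem_univ _, h2⟩
          rcases (le_last i).lt_or_eq with hi | rfl
          · exact (h1 i hi).le
          · exact h2.le
        rw [degree_lexBound hd] at h3
        omega
      · rw [lexBound_of_ne h.ne' hj] at h2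
        omega
  · rintro ⟨h1, h2⟩
    refine ⟨σ.δ, fun i hi => ?_, by rwa [lexBound_δ]⟩
    rw [h1 i hi, lexBound_of_ne hi.ne (hi.trans δ_lt_last).ne]

theorem mem_basisMons {d : ℕ} {m : σ.Mon} :
    m ∈ σ.basisMons d ↔ m.degree = d ∧ (d < σ.r ∨ d ≤ σ.s ∧ σ.Low m) := by
  unfold basisMons
  split_ifs with h1 h2
  · simp [mem_mons, h1]
  · simp only [Finset.mem_filter, mem_mons, h1, h2, false_or, true_and]
    refine and_congr_right fun h => ?_
    rw [lt_lexBound_iff (not_lt.1 h1) h, and_iff_right_iff_imp]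
    exact fun h => h.1
  · simp [h1, h2]

theorem mem_orderIdeal {m : σ.Mon} :
    m ∈ σ.orderIdeal ↔ m.degree < σ.r ∨ m.degree ≤ σ.s ∧ σ.Low m := by
  have := σ.r_lt_s
  simp only [orderIdeal, Finset.mem_biUnion, Finset.mem_range, mem_basisMons]
  constructor
  · rintro ⟨d, hd, rfl, h⟩
    exact h
  · intro h
    exact ⟨_, by omega, rfl, h⟩

theorem mem_leadMons {m : σ.Mon} : m ∈ σ.leadMons ↔ m.degree = σ.r ∧ ¬ σ.Low m := by
  simp only [leadMons, Finset.mem_filter, mem_mons]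
  exact and_congr_right fun h => by rw [← not_lt, lt_lexBound_iff le_rfl h]

theorem mem_trailMons {m : σ.Mon} : m ∈ σ.trailMons ↔ m.degree = σ.s ∧ σ.Low m := by
  have := σ.r_lt_s
  simp only [trailMons, mem_basisMons, le_refl, true_and]
  exact and_congr_right fun _ => ⟨fun h => h.resolve_left (by omega), Or.inr⟩

theorem mem_tar' {m : σ.Mon} :
    m ∈ σ.tar' ↔ σ.r ≤ m.degree ∧ m.degree < σ.s ∧ σ.Low m := by
  simp only [tar', Finset.mem_biUnion, Finset.mem_Ico, mem_basisMons]
  constructor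
  · rintro ⟨d, hd, rfl, h⟩
    exact ⟨hd.1, hd.2, (h.resolve_left (by omega)).2⟩
  · rintro ⟨h1, h2, h3⟩
    exact ⟨_, ⟨h1, h2⟩, rfl, Or.inr ⟨h2.le, h3⟩⟩

theorem mem_tar'' {m : σ.Mon} :
    m ∈ σ.tar'' ↔ (σ.r ≤ m.degree ∧ m.degree < σ.s ∧ σ.Low m) ∧ σ.w ≤ m σ.next := by
  rw [tar'', Finset.mem_filter, mem_tar']

theorem low_of_le {a b : σ.Mon} (h : a ≤ b) (hb : σ.Low b) : σ.Low a :=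
  ⟨fun i hi => Nat.le_zero.1 ((h i).trans (hb.1 i hi).le), (h _).trans_lt hb.2⟩

theorem low_zero : σ.Low 0 := ⟨fun _ _ => rfl, by have := σ.one_le_sub; simp; omega⟩

/-- A back variable times a low monomial is low. -/
theorem low_single_add {i : Fin σ.n} (hi : σ.δ < i) {m : σ.Mon} (hm : σ.Low m) (a : ℕ) :
    σ.Low (Finsupp.single i a + m) :=
  ⟨noFront_add.2 ⟨noFront_single hi.le _, hm.1⟩, by
    simpa [Finsupp.single_apply, hi.ne'] using hm.2⟩

theorem mem_shiftMons {α : Fin σ.n} (hα : α < σ.δ) {m : σ.Mon} :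
    m ∈ σ.shiftMons α ↔ m.degree + σ.r ≤ σ.s ∧ σ.Low m := by
  have h1 := σ.r_lt_s
  have h2 := σ.two_le_r
  have h3 : (m + Finsupp.single σ.last (σ.r - 1)).degree = m.degree + (σ.r - 1) := by
    rw [map_add, Finsupp.degree_single]
  have h4 : σ.Low (m + Finsupp.single σ.last (σ.r - 1)) ↔ σ.Low m :=
    ⟨low_of_le (by simp), fun h => by rw [add_comm]; exact low_single_add δ_lt_last h _⟩
  simp only [shiftMons, if_pos hα, Finset.mem_filter, Finset.mem_biUnion, Finset.mem_range,
    mem_mons, mem_tar', h3, h4]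
  constructor
  · rintro ⟨-, -, h | h⟩
    · rw [add_eq_right] at h
      subst h
      exact ⟨by simp; omega, low_zero⟩
    · exact ⟨by omega, h.2.2⟩
  · rintro ⟨h, h'⟩
    refine ⟨⟨_, by omega, rfl⟩, h'.1, ?_⟩
    by_cases h0 : m.degree = 0
    · left
      rw [Finsupp.degree_eq_zero_iff] at h0
      rw [h0, zero_add]
    · right
      exact ⟨by omega, by omega, h'⟩

theorem mem_shiftMons_of_le {α : Fin σ.n} (hα : σ.δ ≤ α) {m : σ.Mon} :
    m ∈ σ.shiftMons α ↔ m = 0 := by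
  simp [shiftMons, if_neg hα.not_gt]

theorem mem_border_of_degree {b : σ.Mon} (hb : b.degree = σ.r) (h : ¬ σ.Low b) :
    b ∈ σ.border := by
  have h2 := σ.two_le_r
  refine ⟨fun h' => ?_, ?_⟩
  · rw [mem_orderIdeal] at h'
    rcases h' with h' | h'
    · omega
    · exact h h'.2
  · have : b ≠ 0 := by rintro rfl; simp at hb; omega
    obtain ⟨i, hi⟩ := Finsupp.ne_iff.1 this
    have e : b - Finsupp.single i 1 + Finsupp.single i 1 = b :=
      tsub_add_cancel_of_le (Finsupp.single_le_iff.2 (Nat.one_le_iff_ne_zero.2 hi))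
    refine ⟨b - Finsupp.single i 1, mem_orderIdeal.2 (Or.inl ?_), i, e.symm⟩
    have := congrArg Finsupp.degree e
    rw [map_add, Finsupp.degree_single] at this
    omega

theorem inSL_iff {b : σ.Mon} :
    σ.InSL b ↔ b.degree = σ.r ∧ σ.NoFront b ∧ σ.r - σ.w ≤ b σ.δ := by
  rw [InSL, mem_leadMons]
  constructor
  · rintro ⟨⟨h1, h2⟩, h3⟩
    exact ⟨h1, h3, not_lt.1 fun h => h2 ⟨h3, h⟩⟩
  · rintro ⟨h1, h2, h3⟩
    exact ⟨⟨h1, fun h => absurd h.2 (not_lt.2 h3)⟩, h2⟩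

/-- A border monomial of degree above r is a variable times a monomial of 𝒪 of degree at least r,
which is low. To leave the low monomials without a front variable, the variable must be x_δ and the
exponent must reach r-w exactly. -/
theorem inSD_iff {b : σ.Mon} :
    σ.InSD b ↔ σ.NoFront b ∧ b σ.δ = σ.r - σ.w ∧ σ.r + 1 ≤ b.degree ∧ b.degree ≤ σ.s := by
  have h1 := σ.one_le_sub
  constructor
  · rintro ⟨⟨h1, t, ht, i, rfl⟩, h2, h3, h4⟩
    refine ⟨h2, ?_, h3, h4⟩
    have h5 : σ.r - σ.w ≤ (t + Finsupp.single i 1 : σ.Mon) σ.δ := not_lt.1 fun h =>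
      h1 (mem_orderIdeal.2 (Or.inr ⟨h4, h2, h⟩))
    rw [map_add, Finsupp.degree_single] at h3
    have h6 := (mem_orderIdeal.1 ht).resolve_left (by omega)
    have h7 := h6.2.2
    rw [Finsupp.add_apply, Finsupp.single_apply] at h5 ⊢
    split_ifs at h5 ⊢ <;> omega
  · rintro ⟨h2, h3, h4, h5⟩
    have e : b - Finsupp.single σ.δ 1 + Finsupp.single σ.δ 1 = b :=
      tsub_add_cancel_of_le (Finsupp.single_le_iff.2 (by omega))
    have h6 := congrArg Finsupp.degree e
    rw [map_add, Finsupp.degree_single] at h6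
    refine ⟨⟨fun h => ?_, _, mem_orderIdeal.2 (Or.inr ⟨?_, ?_⟩), σ.δ, e.symm⟩, h2, h4, h5⟩
    · have := ((mem_orderIdeal.1 h).resolve_left (by omega)).2.2
      omega
    · omega
    · refine ⟨fun i hi => ?_, ?_⟩
      · have := h2 i hi
        simp [this]
      · simp; omega

theorem degree_of_mem_border {b : σ.Mon} (hb : b ∈ σ.border) :
    σ.r ≤ b.degree ∧ b.degree ≤ σ.s + 1 := by
  have := σ.r_lt_s
  obtain ⟨h, t, ht, i, rfl⟩ := hb
  rw [mem_orderIdeal] at h ht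
  rw [map_add, Finsupp.degree_single] at *
  push Not at h
  exact ⟨h.1, by omega⟩

/-- A boundary monomial without front variables lies in `𝒮_L` or in `𝒮_D` or has degree `s + 1`. -/
theorem border_cases {b : σ.Mon} (hb : b ∈ σ.border) (h : σ.NoFront b) :
    σ.InSL b ∨ σ.InSD b ∨ b.degree = σ.s + 1 := by
  obtain ⟨h1, h2⟩ := degree_of_mem_border hb
  have h3 : b.degree ≤ σ.s → ¬ σ.Low b := fun h h' => hb.1 (mem_orderIdeal.2 (Or.inr ⟨h, h'⟩))
  rcases h1.eq_or_lt with h4 | h4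
  · exact Or.inl ⟨mem_leadMons.2 ⟨h4.symm, h3 (by have := σ.r_lt_s; omega)⟩, h⟩
  · by_cases h5 : b.degree ≤ σ.s
    · exact Or.inr (Or.inl ⟨hb, h, h4, h5⟩)
    · exact Or.inr (Or.inr (by omega))

theorem not_inSD_of_inSL {b : σ.Mon} (h : σ.InSL b) : ¬ σ.InSD b := fun h' => by
  have := (inSL_iff.1 h).1
  have := (inSD_iff.1 h').2.2.1
  omega

theorem segTop_δ (e : ℕ) : σ.segTop e σ.δ = σ.r - e := by
  simp [segTop, δ_lt_next.ne']

theorem noFront_segTop (e : ℕ) : σ.NoFront (σ.segTop e) :=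
  noFront_add.2 ⟨noFront_single le_rfl _, noFront_single δ_lt_next.le _⟩

theorem degree_segTop {e : ℕ} (h : e ≤ σ.r) : (σ.segTop e).degree = σ.r := by
  simp only [segTop, map_add, Finsupp.degree_single]
  omega

end Monomials

end Signature

namespace Signature

variable {σ : Signature} {R : Type*} [CommRing R]

/-! ### Truncation by degree -/

section Truncation

@[simp]
theorem onMons_monomial (φ : σ.Mon → MvPolynomial (Fin σ.n) R) (m : σ.Mon) :
    σ.onMons φ (monomial m 1) = φ m := by
  have := (basisMonomials (Fin σ.n) R).constr_basis R φ m
  rwa [coe_basisMonomials] at this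

variable (σ R) in
/-- The truncation of polynomials that deletes the terms of degree greater than `d`. -/
def trunc (d : ℕ) : MvPolynomial (Fin σ.n) R →ₗ[R] MvPolynomial (Fin σ.n) R :=
  σ.onMons fun m => if m.degree ≤ d then monomial m 1 else 0

variable (σ R) in
/-- The polynomials of order at least `d`. -/
abbrev ordGe (d : ℕ) : Submodule R (MvPolynomial (Fin σ.n) R) :=
  restrictSupport R {m | d ≤ m.degree}

variable (σ R) in
/-- The polynomials supported on low monomials. -/
abbrev lowSpan : Submodule R (MvPolynomial (Fin σ.n) R) :=
  restrictSupport R {m | σ.Low m}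

theorem trunc_monomial (d : ℕ) (m : σ.Mon) :
    σ.trunc R d (monomial m 1) = if m.degree ≤ d then monomial m 1 else 0 :=
  onMons_monomial _ _

theorem trunc_eq_self {d : ℕ} {p : MvPolynomial (Fin σ.n) R}
    (hp : p ∈ restrictSupport R {m : σ.Mon | m.degree ≤ d}) : σ.trunc R d p = p :=
  map_eq_of_mem_restrictSupport (σ.trunc R d) LinearMap.id
    (fun m hm => by rw [trunc_monomial, if_pos (show m.degree ≤ d from hm)]; rfl) hp

theorem trunc_eq_zero {d : ℕ} {p : MvPolynomial (Fin σ.n) R}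
    (hp : p ∈ σ.ordGe R (d + 1)) : σ.trunc R d p = 0 :=
  map_eq_of_mem_restrictSupport (σ.trunc R d) 0
    (fun m hm => by
      have : ¬ m.degree ≤ d := by have : d + 1 ≤ m.degree := hm; omega
      rw [trunc_monomial, if_neg this]; rfl) hp

theorem sub_trunc_mem (d : ℕ) (p : MvPolynomial (Fin σ.n) R) :
    p - σ.trunc R d p ∈ σ.ordGe R (d + 1) := by
  refine map_mem_of_mem_restrictSupport (S := Set.univ) (LinearMap.id - σ.trunc R d)
    (fun m _ => ?_) (by rw [restrictSupport_univ]; trivial)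
  rw [LinearMap.sub_apply, trunc_monomial]
  split_ifs with h
  · simp
  · simp only [LinearMap.id_apply, sub_zero]
    exact (monomial_mem_restrictSupport R).2 (Or.inl (by simp; omega))

theorem trunc_mem {S : Set σ.Mon} (d : ℕ) {p : MvPolynomial (Fin σ.n) R}
    (hp : p ∈ restrictSupport R S) :
    σ.trunc R d p ∈ restrictSupport R {m | m ∈ S ∧ m.degree ≤ d} := by
  refine map_mem_of_mem_restrictSupport _ (fun m hm => ?_) hp
  rw [trunc_monomial]
  split_ifs with h
  · exact (monomial_mem_restrictSupport R).2 (Or.inl ⟨hm, h⟩)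
  · exact zero_mem _

theorem trunc_monomial_mul {a : σ.Mon} {d e : ℕ} (h : a.degree + d = e)
    (p : MvPolynomial (Fin σ.n) R) :
    σ.trunc R e (monomial a 1 * p) = monomial a 1 * σ.trunc R d p := by
  refine map_eq_of_monomial (σ.trunc R e ∘ₗ LinearMap.mulLeft R (monomial a 1))
    (LinearMap.mulLeft R (monomial a 1) ∘ₗ σ.trunc R d) (fun m => ?_) p
  simp only [LinearMap.comp_apply, LinearMap.mulLeft_apply, monomial_mul, mul_one,
    trunc_monomial, map_add]
  have : a.degree + m.degree ≤ e ↔ m.degree ≤ d := by omega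
  simp only [this]
  split_ifs <;> simp

end Truncation

/-! ### Division by f = x_δ^{r-w} + U and the front variables -/

section Reduction

variable (θ : σ.ΘIdx → R)

/-- The initial target divided by `x_{δ+1}^w`. -/
def reducedTarget : MvPolynomial (Fin σ.n) R :=
  ∑ q : σ.ΘIdx, monomial (q.1 - Finsupp.single σ.next σ.w) (θ q)

theorem initTarget_eq :
    σ.initTarget θ = monomial (Finsupp.single σ.next σ.w) 1 * σ.reducedTarget θ := by
  rw [initTarget, reducedTarget, Finset.mul_sum]
  refine Finset.sum_congr rfl fun q _ => ?_
  rw [monomial_mul, one_mul,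
    add_tsub_cancel_of_le (Finsupp.single_le_iff.2 (mem_tar''.1 q.2).2)]

/-- The lower bound r-w on the degree is what keeps division by f from lowering the order: x_δ^{r-w}
is replaced by terms of at least the same degree. -/
theorem reducedTarget_mem :
    σ.reducedTarget θ ∈ restrictSupport R {m : σ.Mon | σ.Low m ∧ σ.r - σ.w ≤ m.degree} := by
  refine Submodule.sum_mem _ fun q _ => (monomial_mem_restrictSupport R).2 (Or.inl ?_)
  obtain ⟨⟨h1, h2, h3⟩, h4⟩ := mem_tar''.1 q.2
  refine ⟨low_of_le tsub_le_self h3, ?_⟩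
  have e := tsub_add_cancel_of_le (Finsupp.single_le_iff.2 h4)
  have := congrArg Finsupp.degree e
  rw [map_add, Finsupp.degree_single] at this
  omega

/-- One step of the division by `f = x_δ^{r-w} + U`, where `U` is the reduced target. -/
def divStep : MvPolynomial (Fin σ.n) R →ₗ[R] MvPolynomial (Fin σ.n) R :=
  σ.onMons fun m => if m σ.δ < σ.r - σ.w then monomial m 1
    else -(monomial (m - Finsupp.single σ.δ (σ.r - σ.w)) 1 * σ.reducedTarget θ)

/-- The remainder of `x_δ^a` under division by `f`. -/
def powRem : ℕ → MvPolynomial (Fin σ.n) R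
  | 0 => 1
  | a + 1 => σ.divStep θ (X σ.δ * powRem a)

/-- The remainder under division by `f` and the front variables. -/
def rem : MvPolynomial (Fin σ.n) R →ₗ[R] MvPolynomial (Fin σ.n) R :=
  σ.onMons fun m => if σ.NoFront m then monomial (m.erase σ.δ) 1 * σ.powRem θ (m σ.δ) else 0

theorem rem_monomial (m : σ.Mon) : σ.rem θ (monomial m 1) =
    if σ.NoFront m then monomial (m.erase σ.δ) 1 * σ.powRem θ (m σ.δ) else 0 :=
  onMons_monomial _ _

/-- For x_δ-degree at most r-w one step is a complete division: the quotient of a monomial that is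
reduced involves no x_δ, and U is already low. -/
theorem divStep_mem {d : ℕ} {p : MvPolynomial (Fin σ.n) R}
    (hp : p ∈ restrictSupport R {m : σ.Mon | σ.NoFront m ∧ m σ.δ ≤ σ.r - σ.w ∧ d ≤ m.degree}) :
    σ.divStep θ p ∈ restrictSupport R {m : σ.Mon | σ.Low m ∧ d ≤ m.degree} := by
  refine map_mem_of_mem_restrictSupport _ ?_ hp
  rintro m ⟨h1, h2, h3⟩
  rw [divStep, onMons_monomial]
  split_ifs with h
  · exact (monomial_mem_restrictSupport R).2 (Or.inl ⟨⟨h1, h⟩, h3⟩)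
  · refine Submodule.neg_mem _ (monomial_mul_mem_restrictSupport 1 ?_ (reducedTarget_mem θ))
    rintro m' ⟨h4, h5⟩
    -- Hence m / x_δ^{r-w} has only back variables and keeps U low.
    have h6 : m σ.δ = σ.r - σ.w := le_antisymm h2 (not_lt.1 h)
    have e := tsub_add_cancel_of_le (Finsupp.single_le_iff.2 h6.ge)
    have h7 := congrArg Finsupp.degree e
    rw [map_add, Finsupp.degree_single] at h7
    refine ⟨⟨noFront_add.2 ⟨fun i hi => ?_, h4.1⟩, ?_⟩, ?_⟩
    · have := h1 i hi
      simp [this]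
    · have := h4.2
      simp [h6, this]
    · rw [map_add]
      omega

theorem powRem_mem (a : ℕ) :
    σ.powRem θ a ∈ restrictSupport R {m : σ.Mon | σ.Low m ∧ a ≤ m.degree} := by
  induction a with
  | zero => exact (monomial_mem_restrictSupport R).2 (Or.inl ⟨low_zero, Nat.zero_le _⟩)
  | succ a ih =>
    refine divStep_mem θ (X_mul_mem_restrictSupport ?_ ih)
    rintro m ⟨h1, h2⟩
    refine ⟨noFront_add.2 ⟨noFront_single le_rfl _, h1.1⟩, ?_, ?_⟩
    · have := h1.2
      simp; omega
    · simp; omega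

theorem powRem_of_lt {a : ℕ} (ha : a < σ.r - σ.w) :
    σ.powRem θ a = monomial (Finsupp.single σ.δ a) 1 := by
  induction a with
  | zero => simp [powRem]
  | succ a ih =>
    rw [powRem, ih (by omega), X, monomial_mul, one_mul, divStep, onMons_monomial, if_pos]
    · rw [← Finsupp.single_add, add_comm]
    · simp; omega

theorem powRem_self : σ.powRem θ (σ.r - σ.w) = -σ.reducedTarget θ := by
  have h := σ.one_le_sub
  obtain ⟨a, ha⟩ : ∃ a, σ.r - σ.w = a + 1 := ⟨_, (Nat.sub_add_cancel h).symm⟩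
  rw [ha, powRem, powRem_of_lt θ (by omega), X, monomial_mul, one_mul, ← Finsupp.single_add,
    add_comm, ← ha, divStep, onMons_monomial, if_neg (by simp)]
  simp

theorem rem_monomial_of_low {m : σ.Mon} (hm : σ.Low m) : σ.rem θ (monomial m 1) = monomial m 1 := by
  rw [rem_monomial, if_pos hm.1, powRem_of_lt θ hm.2, monomial_mul, one_mul, erase_add_single]

theorem rem_eq_self {p : MvPolynomial (Fin σ.n) R} (hp : p ∈ σ.lowSpan R) : σ.rem θ p = p :=
  map_eq_of_mem_restrictSupport (σ.rem θ) LinearMap.id (fun _ hm => rem_monomial_of_low θ hm) hp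

theorem rem_monomial_mem (m : σ.Mon) :
    σ.rem θ (monomial m 1) ∈ restrictSupport R {m' : σ.Mon | σ.Low m' ∧ m.degree ≤ m'.degree} := by
  rw [rem_monomial]
  split_ifs with h
  · refine monomial_mul_mem_restrictSupport 1 ?_ (powRem_mem θ _)
    rintro m' ⟨h1, h2⟩
    refine ⟨⟨noFront_add.2 ⟨noFront_erase h, h1.1⟩, ?_⟩, ?_⟩
    · simpa using h1.2
    · rw [map_add]
      have := degree_erase m
      omega
  · exact zero_mem _

theorem rem_mem_lowSpan (p : MvPolynomial (Fin σ.n) R) : σ.rem θ p ∈ σ.lowSpan R :=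
  map_mem_of_mem_restrictSupport (S := Set.univ) _ (fun m _ =>
    restrictSupport_mono R (fun _ h => h.1) (rem_monomial_mem θ m))
    (by rw [restrictSupport_univ]; trivial)

theorem rem_mem_ordGe {d : ℕ} {p : MvPolynomial (Fin σ.n) R} (hp : p ∈ σ.ordGe R d) :
    σ.rem θ p ∈ σ.ordGe R d := by
  refine map_mem_of_mem_restrictSupport _ (fun m hm => ?_) hp
  refine restrictSupport_mono R ?_ (rem_monomial_mem θ m)
  rintro m' ⟨-, h⟩
  exact le_trans (show d ≤ m.degree from hm) h

/-- Division takes place in x_δ alone, so monomials in the back variables act as scalars. -/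
theorem rem_monomial_mul {a : σ.Mon} (ha : σ.NoFront a) (ha' : a σ.δ = 0)
    (p : MvPolynomial (Fin σ.n) R) :
    σ.rem θ (monomial a 1 * p) = monomial a 1 * σ.rem θ p := by
  refine map_eq_of_monomial (σ.rem θ ∘ₗ LinearMap.mulLeft R (monomial a 1))
    (LinearMap.mulLeft R (monomial a 1) ∘ₗ σ.rem θ) (fun m => ?_) p
  simp only [LinearMap.comp_apply, LinearMap.mulLeft_apply, monomial_mul, mul_one, rem_monomial,
    noFront_add, ha, true_and]
  have e : (a + m).erase σ.δ = a + m.erase σ.δ := by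
    rw [Finsupp.erase_add]
    congr 1
    exact Finsupp.erase_of_notMem_support (by simpa using ha')
  split_ifs
  · rw [e, Finsupp.add_apply, ha', zero_add, ← mul_assoc, monomial_mul, one_mul]
  · rw [mul_zero]

theorem rem_X_mul_of_front {i : Fin σ.n} (hi : i < σ.δ) (p : MvPolynomial (Fin σ.n) R) :
    σ.rem θ (X i * p) = 0 := by
  have h := map_eq_of_monomial (σ.rem θ ∘ₗ LinearMap.mulLeft R (X i)) 0 (fun m => ?_) p
  · simpa only [LinearMap.comp_apply, LinearMap.mulLeft_apply, LinearMap.zero_apply] using h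
  rw [LinearMap.comp_apply, LinearMap.mulLeft_apply, X, monomial_mul, one_mul, rem_monomial,
    if_neg, LinearMap.zero_apply]
  exact fun h => not_noFront_single hi one_ne_zero (noFront_add.1 h).1

theorem rem_X_mul_of_low {p : MvPolynomial (Fin σ.n) R} (hp : p ∈ σ.lowSpan R) :
    σ.rem θ (X σ.δ * p) = σ.divStep θ (X σ.δ * p) := by
  refine map_eq_of_mem_restrictSupport (σ.rem θ ∘ₗ LinearMap.mulLeft R (X σ.δ))
    (σ.divStep θ ∘ₗ LinearMap.mulLeft R (X σ.δ)) (fun m hm => ?_) hp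
  simp only [LinearMap.comp_apply, LinearMap.mulLeft_apply]
  rw [X, monomial_mul, one_mul]
  have h1 : σ.NoFront (Finsupp.single σ.δ 1 + m) :=
    noFront_add.2 ⟨noFront_single le_rfl _, hm.1⟩
  have h2 := hm.2
  rw [divStep, onMons_monomial]
  split_ifs with h
  · exact rem_monomial_of_low θ ⟨h1, h⟩
  · have h3 : (Finsupp.single σ.δ 1 + m : σ.Mon) σ.δ = σ.r - σ.w := by
      simp at h ⊢; omega
    rw [rem_monomial, if_pos h1, h3, powRem_self, mul_neg]
    congr 3
    rw [← h3]
    exact congrArg monomial (eq_tsub_of_add_eq (erase_add_single _))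

/-- The kernel of the remainder map is an ideal. -/
theorem rem_X_mul_rem (i : Fin σ.n) (p : MvPolynomial (Fin σ.n) R) :
    σ.rem θ (X i * σ.rem θ p) = σ.rem θ (X i * p) := by
  rcases lt_trichotomy i σ.δ with hi | hi | hi
  · rw [rem_X_mul_of_front θ hi, rem_X_mul_of_front θ hi]
  · subst hi
    refine map_eq_of_monomial (σ.rem θ ∘ₗ LinearMap.mulLeft R (X σ.δ) ∘ₗ σ.rem θ)
      (σ.rem θ ∘ₗ LinearMap.mulLeft R (X σ.δ)) (fun m => ?_) p
    simp only [LinearMap.comp_apply, LinearMap.mulLeft_apply]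
    rw [X, monomial_mul, one_mul, ← X, rem_monomial, rem_monomial, noFront_add]
    simp only [noFront_single le_rfl, true_and]
    split_ifs with h
    -- After the back variables are pulled out, both sides are the recursion that passes from the
    -- remainder of x_δ^a to that of x_δ^{a+1}.
    · rw [mul_left_comm, rem_monomial_mul θ (noFront_erase h) (by simp),
        rem_X_mul_of_low θ (restrictSupport_mono R (fun _ h => h.1) (powRem_mem θ _)),
        ← powRem, Finsupp.erase_add, Finsupp.erase_single, zero_add]
      simp [add_comm]
    · simp
  · have h1 : σ.NoFront (Finsupp.single i 1) := noFront_single hi.le _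
    have h2 : (Finsupp.single i 1 : σ.Mon) σ.δ = 0 := by simp [hi.ne]
    rw [X, rem_monomial_mul θ h1 h2, rem_monomial_mul θ h1 h2, rem_eq_self θ (rem_mem_lowSpan θ p)]

end Reduction

/-! ### The targets Υ(b) as truncated remainders -/

section Target

variable (θ : σ.ΘIdx → R)

/-- Exactness of the division by b_e: its x_δ-part cancels against that of b and its x_{δ+1}-part
against the explicit factor x_{δ+1}^e. -/
theorem transport_monomial_mul {e : ℕ} {b : σ.Mon} (hb : b σ.δ = σ.r - e)
    (p : MvPolynomial (Fin σ.n) R) :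
    σ.transport e b (monomial (Finsupp.single σ.next e) 1 * p) =
      monomial (b.erase σ.δ) 1 * p := by
  rw [transport, ← mul_assoc, monomial_mul, one_mul]
  have : b + Finsupp.single σ.next e = σ.segTop e + b.erase σ.δ := by
    conv_lhs => rw [← erase_add_single b, hb]
    rw [segTop]
    abel
  rw [this, ← one_mul (1 : R), ← monomial_mul, mul_assoc, divMonomial_monomial_mul, one_mul]

theorem rem_segTop (e : ℕ) : σ.rem θ (monomial (σ.segTop e) 1) =
    monomial (Finsupp.single σ.next e) 1 * σ.powRem θ (σ.r - e) := by
  rw [rem_monomial, if_pos (noFront_segTop e), segTop_δ]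
  congr 2
  rw [segTop, Finsupp.erase_add, Finsupp.erase_single, zero_add,
    Finsupp.erase_single_ne δ_lt_next.ne]

theorem targetD_eq {b : σ.Mon} (hb : σ.InSD b) :
    σ.targetD θ b = -σ.trunc R σ.s (σ.rem θ (monomial b 1)) := by
  obtain ⟨h1, h2, -, -⟩ := inSD_iff.1 hb
  rw [targetD, initTarget_eq, transport_monomial_mul h2, rem_monomial, if_pos h1, h2, powRem_self,
    mul_neg, map_neg, neg_neg]
  rfl

theorem red_eq {p : MvPolynomial (Fin σ.n) R}
    (hp : p ∈ restrictSupport R {m : σ.Mon | σ.NoFront m ∧ m σ.δ ≤ σ.r - σ.w ∧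
      σ.r + 1 ≤ m.degree ∧ m.degree ≤ σ.s}) :
    σ.red θ p = σ.trunc R σ.s (σ.rem θ p) := by
  refine map_eq_of_mem_restrictSupport (σ.red θ) (σ.trunc R σ.s ∘ₗ σ.rem θ) ?_ hp
  rintro m ⟨h1, h2, h3, h4⟩
  rw [red, onMons_monomial, LinearMap.comp_apply]
  by_cases h : m σ.δ < σ.r - σ.w
  · rw [if_pos (mem_orderIdeal.2 (Or.inr ⟨h4, h1, h⟩)), rem_monomial_of_low θ ⟨h1, h⟩, trunc_monomial, if_pos h4]
  · have hD : σ.InSD m := inSD_iff.2 ⟨h1, le_antisymm h2 (not_lt.1 h), h3, h4⟩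
    rw [if_neg, if_pos hD, targetD_eq θ hD, neg_neg]
    rw [mem_orderIdeal]
    rintro (h5 | h5)
    · omega
    · exact h h5.2.2

theorem initTarget_mem :
    σ.initTarget θ ∈ restrictSupport R {m : σ.Mon | σ.Low m ∧ σ.r ≤ m.degree ∧ m.degree < σ.s} :=
  Submodule.sum_mem _ fun q _ => by
    have := (mem_tar''.1 q.2).1
    exact (monomial_mem_restrictSupport R).2 (Or.inl ⟨this.2.2, this.1, this.2.1⟩)

theorem trunc_rem_monomial_mem (d : ℕ) (b : σ.Mon) :
    σ.trunc R d (σ.rem θ (monomial b 1)) ∈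
      restrictSupport R {m : σ.Mon | (σ.Low m ∧ b.degree ≤ m.degree) ∧ m.degree ≤ d} :=
  trunc_mem d (rem_monomial_mem θ b)

/-- The recursion follows the identity x_δ b_e = x_{δ+1} b_{e-1}. The map `red` is the remainder
truncated above s, x_{δ+1} passes through the remainder, and dividing by it lowers the truncation
degree to s-1. In particular the division is exact. -/
theorem topTarget_eq {i : ℕ} (hi : i ≤ σ.w) :
    σ.topTarget θ i = -σ.trunc R (σ.s - 1) (σ.rem θ (monomial (σ.segTop (σ.w - i)) 1)) := by
  have hw := σ.w_lt_r
  have hs := σ.r_lt_s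
  induction i with
  | zero =>
    rw [topTarget, tsub_zero, rem_segTop, powRem_self, mul_neg, ← initTarget_eq, map_neg, neg_neg,
      trunc_eq_self]
    refine restrictSupport_mono R ?_ (initTarget_mem θ)
    rintro m ⟨-, -, h⟩
    simp only [Set.mem_ofPred_eq]
    omega
  | succ i ih =>
    set b := σ.segTop (σ.w - i) with hb
    set q := σ.trunc R (σ.s - 1) (σ.rem θ (monomial b 1)) with hq
    have hbr : b.degree = σ.r := degree_segTop (by omega)
    -- Here q is low with degrees from r to s-1, so multiplying by x_δ lands in the range where
    -- `red_eq` applies.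
    have h1 : X σ.δ * -q ∈ restrictSupport R {m : σ.Mon | σ.NoFront m ∧ m σ.δ ≤ σ.r - σ.w ∧
        σ.r + 1 ≤ m.degree ∧ m.degree ≤ σ.s} := by
      refine X_mul_mem_restrictSupport ?_
        (Submodule.neg_mem _ (trunc_rem_monomial_mem θ (σ.s - 1) b))
      rintro m ⟨⟨h1, h2⟩, h3⟩
      have := h1.2
      refine ⟨noFront_add.2 ⟨noFront_single le_rfl _, h1.1⟩, ?_, ?_, ?_⟩
      · simp; omega
      · simp; omega
      · simp; omega
    -- The terms lost by truncating above s-1 have degree at least s; times x_δ they exceed s, so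
    -- the next truncation cannot see the loss.
    have h2 : X σ.δ * (σ.rem θ (monomial b 1) - q) ∈ σ.ordGe R (σ.s + 1) := by
      refine X_mul_mem_restrictSupport ?_ (sub_trunc_mem _ _)
      intro m hm
      have : σ.s - 1 + 1 ≤ m.degree := hm
      simp; omega
    have h3 : σ.trunc R σ.s (σ.rem θ (X σ.δ * q)) =
        σ.trunc R σ.s (σ.rem θ (X σ.δ * monomial b 1)) := by
      have := trunc_eq_zero (rem_mem_ordGe θ h2)
      rw [mul_sub, map_sub, map_sub, sub_eq_zero] at this
      rw [← this, rem_X_mul_rem]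
    have h4 : (X σ.δ * monomial b 1 : MvPolynomial (Fin σ.n) R) =
        monomial (Finsupp.single σ.next 1) 1 * monomial (σ.segTop (σ.w - (i + 1))) 1 := by
      rw [X, monomial_mul, monomial_mul]
      congr 1
      rw [hb, segTop, segTop, ← add_assoc, add_left_comm, ← Finsupp.single_add,
        ← Finsupp.single_add, show 1 + (σ.r - (σ.w - i)) = σ.r - (σ.w - (i + 1)) by omega,
        show 1 + (σ.w - (i + 1)) = σ.w - i by omega]
    rw [topTarget, ih (by omega), red_eq θ h1, mul_neg, map_neg, map_neg, h3, h4,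
      rem_monomial_mul θ (noFront_single δ_lt_next.le _) (by simp [δ_lt_next.ne]),
      trunc_monomial_mul (d := σ.s - 1) (by simp; omega), ← mul_neg, divMonomial_monomial_mul]

theorem target_of_inSD {b : σ.Mon} (hb : σ.InSD b) :
    σ.target θ b = -σ.trunc R σ.s (σ.rem θ (monomial b 1)) := by
  rw [target, if_pos hb, targetD_eq θ hb]

theorem target_of_inSL {b : σ.Mon} (hb : σ.InSL b) :
    σ.target θ b = -σ.trunc R (σ.s - 1) (σ.rem θ (monomial b 1)) := by
  have hw := σ.w_lt_r
  have hs := σ.r_lt_s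
  obtain ⟨h1, h2, h3⟩ := inSL_iff.1 hb
  have h4 := apply_le_degree b σ.δ
  obtain ⟨e, he⟩ : ∃ e, σ.r - b σ.δ = e := ⟨_, rfl⟩
  have h5 : b σ.δ = σ.r - e := by omega
  have h6 := degree_erase b
  rw [target, if_neg (not_inSD_of_inSL hb), if_pos hb, he, topTarget_eq θ (Nat.sub_le _ _),
    Nat.sub_sub_self (by omega), rem_segTop,
    -- Both b_e and b have back part of degree e, so pulling it out shifts the truncation degree
    -- from s-1 to s-1-e in the two cases alike.
    trunc_monomial_mul (d := σ.s - 1 - e) (by simp; omega), ← mul_neg, transport_monomial_mul h5,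
    rem_monomial, if_pos h2, trunc_monomial_mul (d := σ.s - 1 - e) (by omega), h5, mul_neg]

theorem target_of_not {b : σ.Mon} (h : ¬ σ.InSD b) (h' : ¬ σ.InSL b) : σ.target θ b = 0 := by
  rw [target, if_neg h, if_neg h']

theorem target_of_not_noFront {b : σ.Mon} (h : ¬ σ.NoFront b) : σ.target θ b = 0 :=
  target_of_not θ (fun h' => h h'.2.1) (fun h' => h h'.2)

theorem target_segTop : σ.target θ (σ.segTop σ.w) = σ.initTarget θ := by
  have hw := σ.w_lt_r
  have hd : (σ.segTop σ.w).degree = σ.r := degree_segTop hw.le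
  rw [target, if_neg (fun h => by have := h.2.2.1; omega),
    if_pos (inSL_iff.2 ⟨hd, noFront_segTop _, (segTop_δ _).ge⟩), segTop_δ,
    Nat.sub_sub_self hw.le, Nat.sub_self, topTarget, transport, divMonomial_monomial_mul]

theorem target_mem (b : σ.Mon) : σ.target θ b ∈
    restrictSupport R {m : σ.Mon | σ.Low m ∧ σ.r ≤ m.degree ∧ m.degree ≤ σ.s} := by
  by_cases h1 : σ.InSD b
  · rw [target_of_inSD θ h1]
    refine restrictSupport_mono R ?_ (Submodule.neg_mem _ (trunc_rem_monomial_mem θ σ.s b))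
    rintro m ⟨⟨h2, h3⟩, h4⟩
    have := h1.2.2.1
    exact ⟨h2, by omega, h4⟩
  · by_cases h2 : σ.InSL b
    · rw [target_of_inSL θ h2]
      refine restrictSupport_mono R ?_
        (Submodule.neg_mem _ (trunc_rem_monomial_mem θ (σ.s - 1) b))
      rintro m ⟨⟨h3, h4⟩, h5⟩
      have := (inSL_iff.1 h2).1
      exact ⟨h3, by omega, by omega⟩
    · rw [target_of_not θ h1 h2]
      exact zero_mem _

end Target

/-! ### The normal form and freeness of the quotient -/

section NormalForm

variable (c : σ.DIdx → R) (θ : σ.ΘIdx → R)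

/-- The combination `∑ c_{t,b} t` of trailing monomials; it is zero if `b` is not leading. -/
def trail (b : σ.Mon) : MvPolynomial (Fin σ.n) R :=
  if h : b ∈ σ.leadMons then
    ∑ t : {t // t ∈ σ.trailMons}, monomial t.1 (c (⟨b, h⟩, t)) else 0

theorem modGen_eq (b : σ.Mon) :
    σ.modGen c θ b = monomial b 1 - σ.trail c b + σ.target θ b := rfl

theorem trail_of_notMem {b : σ.Mon} (h : b ∉ σ.leadMons) : σ.trail c b = 0 := dif_neg h

theorem trail_mem (b : σ.Mon) :
    σ.trail c b ∈ restrictSupport R {m : σ.Mon | σ.Low m ∧ m.degree = σ.s} := by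
  rw [trail]
  split_ifs with h
  · refine Submodule.sum_mem _ fun t _ => (monomial_mem_restrictSupport R).2 (Or.inl ?_)
    exact ⟨(mem_trailMons.1 t.2).2, (mem_trailMons.1 t.2).1⟩
  · exact zero_mem _

/-- The normal form with respect to the mod-distinguished ideal with parameters `c` and `θ`. -/
def normalForm : MvPolynomial (Fin σ.n) R →ₗ[R] MvPolynomial (Fin σ.n) R :=
  σ.onMons fun m => if m.degree < σ.r then monomial m 1
    else if m ∈ σ.leadMons then σ.trail c m - σ.target θ m
    else σ.trunc R σ.s (σ.rem θ (monomial m 1))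

theorem normalForm_monomial (m : σ.Mon) : σ.normalForm c θ (monomial m 1) =
    if m.degree < σ.r then monomial m 1
    else if m ∈ σ.leadMons then σ.trail c m - σ.target θ m
    else σ.trunc R σ.s (σ.rem θ (monomial m 1)) := onMons_monomial _ _

theorem normalForm_of_degree_lt {m : σ.Mon} (h : m.degree < σ.r) :
    σ.normalForm c θ (monomial m 1) = monomial m 1 := by
  rw [normalForm_monomial, if_pos h]

theorem rem_monomial_of_not_noFront {m : σ.Mon} (h : ¬ σ.NoFront m) :
    σ.rem θ (monomial m 1) = 0 := by
  rw [rem_monomial, if_neg h]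

/-- The cases with Υ(b) = 0 outside LM are consistent with division: a front variable makes the
remainder vanish, and in degree s+1 the whole remainder is truncated away. -/
theorem modGen_eq_sub_normalForm {b : σ.Mon} (hb : b ∈ σ.border) :
    σ.modGen c θ b = monomial b 1 - σ.normalForm c θ (monomial b 1) := by
  have hr := degree_of_mem_border hb
  rw [modGen_eq, normalForm_monomial, if_neg hr.1.not_gt]
  split_ifs with h
  · abel
  · rw [trail_of_notMem c h, sub_zero, sub_eq_add_neg]
    congr 1
    by_cases h1 : σ.InSD b
    · exact target_of_inSD θ h1
    · rw [target_of_not θ h1 fun h' => h h'.1, eq_comm, neg_eq_zero]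
      by_cases h2 : σ.NoFront b
      · have h3 := ((border_cases hb h2).resolve_left fun h' => h h'.1).resolve_left h1
        refine trunc_eq_zero (rem_mem_ordGe θ ?_)
        exact (monomial_mem_restrictSupport R).2 (Or.inl h3.ge)
      · rw [rem_monomial_of_not_noFront θ h2, map_zero]

theorem normalForm_of_mem {m : σ.Mon} (h : m ∈ σ.orderIdeal) :
    σ.normalForm c θ (monomial m 1) = monomial m 1 := by
  rw [mem_orderIdeal] at h
  rw [normalForm_monomial]
  split_ifs with h1 h2
  · rfl
  · exact absurd (h.resolve_left h1).2 (mem_leadMons.1 h2).2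
  · obtain ⟨h3, h4⟩ := h.resolve_left h1
    rw [rem_monomial_of_low θ h4, trunc_monomial, if_pos h3]

variable (σ R) in
/-- The polynomials supported on the order ideal. -/
abbrev orderSpan : Submodule R (MvPolynomial (Fin σ.n) R) :=
  restrictSupport R (σ.orderIdeal : Set σ.Mon)

theorem normalForm_eq_self {p : MvPolynomial (Fin σ.n) R} (hp : p ∈ σ.orderSpan R) :
    σ.normalForm c θ p = p :=
  map_eq_of_mem_restrictSupport (σ.normalForm c θ) LinearMap.id
    (fun _ hm => normalForm_of_mem c θ hm) hp

theorem target_mem_orderSpan (b : σ.Mon) : σ.target θ b ∈ σ.orderSpan R :=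
  restrictSupport_mono R (fun _ h => mem_orderIdeal.2 (Or.inr ⟨h.2.2, h.1⟩)) (target_mem θ b)

theorem trail_mem_orderSpan (b : σ.Mon) : σ.trail c b ∈ σ.orderSpan R :=
  restrictSupport_mono R (fun _ h => mem_orderIdeal.2 (Or.inr ⟨h.2.le, h.1⟩)) (trail_mem c b)

theorem normalForm_mem (p : MvPolynomial (Fin σ.n) R) : σ.normalForm c θ p ∈ σ.orderSpan R := by
  refine map_mem_of_mem_restrictSupport (S := Set.univ) _ (fun m _ => ?_)
    (by rw [restrictSupport_univ]; trivial)
  rw [normalForm_monomial]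
  split_ifs with h1 h2
  · exact (monomial_mem_restrictSupport R).2 (Or.inl (mem_orderIdeal.2 (Or.inl h1)))
  · exact sub_mem (trail_mem_orderSpan c m) (target_mem_orderSpan θ m)
  · exact restrictSupport_mono R (fun _ h => mem_orderIdeal.2 (Or.inr ⟨h.2, h.1.1⟩))
      (trunc_rem_monomial_mem θ σ.s m)

/-- The discrepancy consists of trailing terms, of degree s, and of terms cut off above degree s-1
or s. This is why the coefficients C can be arbitrary. -/
theorem normalForm_sub_rem_mem {m : σ.Mon} (hm : σ.r ≤ m.degree) :
    σ.normalForm c θ (monomial m 1) - σ.rem θ (monomial m 1) ∈ σ.ordGe R σ.s := by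
  have hs := σ.r_lt_s
  have h0 : ∀ d, σ.s ≤ d + 1 →
      σ.trunc R d (σ.rem θ (monomial m 1)) - σ.rem θ (monomial m 1) ∈ σ.ordGe R σ.s := by
    intro d hd
    rw [← neg_sub]
    refine Submodule.neg_mem _ (restrictSupport_mono R ?_ (sub_trunc_mem d _))
    intro m' hm'
    exact hd.trans hm'
  rw [normalForm_monomial, if_neg hm.not_gt]
  split_ifs with h
  · rw [sub_sub]
    refine sub_mem (restrictSupport_mono R (fun _ h => h.2.ge) (trail_mem c m)) ?_
    by_cases h1 : σ.NoFront m
    · rw [target_of_inSL θ ⟨h, h1⟩, neg_add_eq_sub, ← neg_sub]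
      exact Submodule.neg_mem _ (h0 _ (by omega))
    · rw [target_of_not_noFront θ h1, rem_monomial_of_not_noFront θ h1, add_zero]
      exact zero_mem _
  · exact h0 _ (by omega)

theorem normalForm_of_ordGe {p : MvPolynomial (Fin σ.n) R} (hp : p ∈ σ.ordGe R (σ.r + 1)) :
    σ.normalForm c θ p = σ.trunc R σ.s (σ.rem θ p) := by
  refine map_eq_of_mem_restrictSupport (σ.normalForm c θ) (σ.trunc R σ.s ∘ₗ σ.rem θ) ?_ hp
  intro m hm
  have : σ.r + 1 ≤ m.degree := hm
  rw [normalForm_monomial, if_neg (by omega), if_neg (by rw [mem_leadMons]; omega),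
    LinearMap.comp_apply]

theorem X_mul_mem_ordGe (i : Fin σ.n) {d : ℕ} {p : MvPolynomial (Fin σ.n) R}
    (hp : p ∈ σ.ordGe R d) : X i * p ∈ σ.ordGe R (d + 1) := by
  refine X_mul_mem_restrictSupport (fun m hm => ?_) hp
  have : d ≤ m.degree := hm
  simp; omega

/-- The kernel of the normal form map is an ideal. -/
theorem normalForm_X_mul (i : Fin σ.n) (p : MvPolynomial (Fin σ.n) R) :
    σ.normalForm c θ (X i * σ.normalForm c θ p) = σ.normalForm c θ (X i * p) := by
  refine map_eq_of_monomial
    (σ.normalForm c θ ∘ₗ LinearMap.mulLeft R (X i) ∘ₗ σ.normalForm c θ)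
    (σ.normalForm c θ ∘ₗ LinearMap.mulLeft R (X i)) (fun m => ?_) p
  simp only [LinearMap.comp_apply, LinearMap.mulLeft_apply]
  by_cases h : m.degree < σ.r
  · rw [normalForm_of_degree_lt c θ h]
  · rw [not_lt] at h
    have h1 := normalForm_sub_rem_mem c θ h
    have h2 : (monomial m 1 : MvPolynomial (Fin σ.n) R) ∈ σ.ordGe R σ.r :=
      (monomial_mem_restrictSupport R).2 (Or.inl h)
    have h3 : σ.normalForm c θ (monomial m 1) ∈ σ.ordGe R σ.r := by
      have := add_mem (restrictSupport_mono R (fun _ h => σ.r_lt_s.le.trans h) h1)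
        (rem_mem_ordGe θ h2)
      rwa [sub_add_cancel] at this
    -- Both sides are now truncated remainders of polynomials of order at least r+1; they differ by
    -- the remainder of x_i times an error of order s, which has order at least s+1.
    rw [normalForm_of_ordGe c θ (X_mul_mem_ordGe i h2),
      normalForm_of_ordGe c θ (X_mul_mem_ordGe i h3), ← rem_X_mul_rem θ i (monomial m 1),
      ← sub_eq_zero, ← map_sub, ← map_sub, ← mul_sub]
    exact trunc_eq_zero (rem_mem_ordGe θ (X_mul_mem_ordGe i h1))

theorem normalForm_mul_eq_zero (a : MvPolynomial (Fin σ.n) R) {p : MvPolynomial (Fin σ.n) R}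
    (hp : σ.normalForm c θ p = 0) : σ.normalForm c θ (a * p) = 0 := by
  induction a using MvPolynomial.induction_on with
  | C a => rw [← smul_eq_C_mul, map_smul, hp, smul_zero]
  | add a b ha hb => rw [add_mul, map_add, ha, hb, add_zero]
  | mul_X a i ih => rw [mul_comm a, mul_assoc, ← normalForm_X_mul, ih, mul_zero, map_zero]

/-- Border-basis rewriting: a variable times a monomial of 𝒪 is either in 𝒪 or in the border, where
the difference is a generator. Induction on the factors of a monomial then reaches every polynomial.
-/
theorem sub_normalForm_mem (p : MvPolynomial (Fin σ.n) R) :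
    p - σ.normalForm c θ p ∈ σ.modIdeal c θ := by
  have h1 : ∀ i, ∀ q ∈ σ.orderSpan R, X i * q - σ.normalForm c θ (X i * q) ∈ σ.modIdeal c θ := by
    intro i q hq
    refine map_mem_of_mem_restrictSupport (W := (σ.modIdeal c θ).restrictScalars R)
      ((LinearMap.id - σ.normalForm c θ) ∘ₗ LinearMap.mulLeft R (X i)) (fun t ht => ?_) hq
    simp only [LinearMap.comp_apply, LinearMap.mulLeft_apply, LinearMap.sub_apply,
      LinearMap.id_apply, Submodule.restrictScalars_mem]
    rw [X, monomial_mul, one_mul]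
    by_cases h : Finsupp.single i 1 + t ∈ σ.orderIdeal
    · rw [normalForm_of_mem c θ h, sub_self]
      exact zero_mem _
    · have hb : Finsupp.single i 1 + t ∈ σ.border := ⟨h, t, ht, i, add_comm _ _⟩
      rw [← modGen_eq_sub_normalForm c θ hb]
      exact Ideal.subset_span ⟨_, hb, rfl⟩
  induction p using MvPolynomial.induction_on with
  | C a =>
    rw [normalForm_eq_self, sub_self]
    · exact zero_mem _
    · refine (monomial_mem_restrictSupport R).2 (Or.inl (mem_orderIdeal.2 (Or.inl ?_)))
      have := σ.two_le_r
      simp; omega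
  | add p q hp hq =>
    rw [map_add, add_sub_add_comm]
    exact add_mem hp hq
  | mul_X p i ih =>
    rw [mul_comm]
    have := add_mem ((σ.modIdeal c θ).mul_mem_left (X i) ih) (h1 i _ (normalForm_mem c θ p))
    rwa [normalForm_X_mul, mul_sub, sub_add_sub_cancel] at this

theorem mem_modIdeal_iff {p : MvPolynomial (Fin σ.n) R} :
    p ∈ σ.modIdeal c θ ↔ σ.normalForm c θ p = 0 := by
  refine ⟨fun h => ?_, fun h => ?_⟩
  · refine Submodule.span_induction ?_ (map_zero _) ?_ ?_ h
    · rintro _ ⟨b, hb, rfl⟩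
      rw [modGen_eq_sub_normalForm c θ hb, map_sub,
        normalForm_eq_self c θ (normalForm_mem c θ _), sub_self]
    · intro p q _ _ hp hq
      rw [map_add, hp, hq, add_zero]
    · intro a p _ hp
      exact normalForm_mul_eq_zero c θ a hp
  · have := sub_normalForm_mem c θ p
    rwa [h, sub_zero] at this

theorem eq_zero_of_mem_modIdeal {p : MvPolynomial (Fin σ.n) R} (h : p ∈ σ.modIdeal c θ)
    (hp : p ∈ σ.orderSpan R) : p = 0 := by
  rw [← normalForm_eq_self c θ hp]
  exact (mem_modIdeal_iff c θ).1 h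

/-- The quotient by a mod-distinguished ideal is free on the order ideal. -/
def quotientEquiv : (MvPolynomial (Fin σ.n) R ⧸ σ.modIdeal c θ) ≃ₗ[R] σ.orderSpan R :=
  (Submodule.Quotient.restrictScalarsEquiv R (σ.modIdeal c θ)).symm.trans <|
    (Submodule.quotEquivOfEq _ _ (by
      ext p
      rw [Submodule.restrictScalars_mem, mem_modIdeal_iff, LinearMap.mem_ker, ← Subtype.coe_inj]
      rfl)).trans <|
    ((σ.normalForm c θ).codRestrict (σ.orderSpan R) (normalForm_mem c θ)).quotKerEquivOfSurjective
      fun p => ⟨p.1, Subtype.ext (normalForm_eq_self c θ p.2)⟩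

/-- The normal form does not change coefficients in degrees below r: it fixes those monomials and
sends all others to order at least r. On the ideal it is zero. -/
theorem mem_ordGe_of_mem_modIdeal {p : MvPolynomial (Fin σ.n) R} (h : p ∈ σ.modIdeal c θ) :
    p ∈ σ.ordGe R σ.r := by
  refine mem_restrictSupport_of_coeff fun m hm => ?_
  have hm' : m.degree < σ.r := not_le.1 hm
  have key : (MvPolynomial.lcoeff R m) p = (MvPolynomial.lcoeff R m ∘ₗ σ.normalForm c θ) p := by
    refine map_eq_of_monomial _ _ (fun m' => ?_) p
    rw [LinearMap.comp_apply]
    by_cases h' : m'.degree < σ.r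
    · rw [normalForm_of_degree_lt c θ h']
    · rw [not_lt] at h'
      have h1 := restrictSupport_mono R (fun _ h => σ.r_lt_s.le.trans h)
        (normalForm_sub_rem_mem c θ h')
      have h2 : (monomial m' 1 : MvPolynomial (Fin σ.n) R) ∈ σ.ordGe R σ.r :=
        (monomial_mem_restrictSupport R).2 (Or.inl h')
      have h3 := add_mem h1 (rem_mem_ordGe θ h2)
      rw [sub_add_cancel] at h3
      rw [lcoeff_apply, lcoeff_apply, coeff_eq_zero_of_mem_restrictSupport h2 hm,
        coeff_eq_zero_of_mem_restrictSupport h3 hm]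
  rw [lcoeff_apply] at key
  rw [key, LinearMap.comp_apply, (mem_modIdeal_iff c θ).1 h, map_zero]

end NormalForm

end Signature

/-! ### Points of the Hilbert scheme from mod-distinguished ideals -/

theorem IsHilbPoint.map_algEquiv {n μ : ℕ} {A : Type*} [CommRing A]
    {I : Ideal (MvPolynomial (Fin n) A)} (hI : IsHilbPoint n μ A I)
    (e : MvPolynomial (Fin n) A ≃ₐ[A] MvPolynomial (Fin n) A) :
    IsHilbPoint n μ A (I.map e) := by
  obtain ⟨h1, h2, h3⟩ := hI
  let e' := (Ideal.quotientEquivAlg I (I.map e) e rfl).toLinearEquiv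
  refine ⟨Module.Finite.equiv e', Module.Projective.of_equiv e', fun P => ?_⟩
  rw [← Module.rankAtStalk_eq_of_equiv e', h3]

theorem MvPolynomial.map_divMonomial {ι R S : Type*} [CommRing R] [CommRing S] (f : R →+* S)
    (p : MvPolynomial ι R) (m : ι →₀ ℕ) :
    MvPolynomial.map f (p.divMonomial m) = (MvPolynomial.map f p).divMonomial m := by
  ext m'
  rw [coeff_map, coeff_divMonomial, coeff_divMonomial, coeff_map]

namespace Signature

variable {σ : Signature} {R S : Type*} [CommRing R] [CommRing S]

theorem isHilbPoint_modIdeal [Nontrivial R] (c : σ.DIdx → R) (θ : σ.ΘIdx → R) :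
    IsHilbPoint σ.n σ.orderIdeal.card R (σ.modIdeal c θ) := by
  let B := (basisRestrictSupport R (σ.orderIdeal : Set σ.Mon)).map (σ.quotientEquiv c θ).symm
  have h1 : Module.Free R (MvPolynomial (Fin σ.n) R ⧸ σ.modIdeal c θ) := Module.Free.of_basis B
  have h2 : Module.Finite R (MvPolynomial (Fin σ.n) R ⧸ σ.modIdeal c θ) := Module.Finite.of_basis B
  refine ⟨h2, inferInstance, fun P => ?_⟩
  rw [Module.rankAtStalk_eq_finrank_of_free, Pi.natCast_apply, Module.finrank_eq_card_basis B]
  simp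

/-! ### The automorphism T*_Z and its inverse -/

section Translation

theorem translate_X (z : σ.ZIdx → R) (α : Fin σ.n) : σ.translate z (X α) =
    X α + ∑ m : {m // m ∈ σ.shiftMons α}, monomial m.1 (z ⟨α, m⟩) := by
  rw [translate, aeval_X]

theorem sum_shiftMons_of_le {M : Type*} [AddCommMonoid M] {α : Fin σ.n} (hα : σ.δ ≤ α)
    (g : {m // m ∈ σ.shiftMons α} → M) :
    ∑ m, g m = g ⟨0, (mem_shiftMons_of_le hα).2 rfl⟩ := by
  refine Finset.sum_eq_single_of_mem _ (Finset.mem_univ _) fun m _ h => ?_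
  exact absurd (Subtype.ext ((mem_shiftMons_of_le hα).1 m.2)) h

/-- The translation of the middle and back variables that is part of `T_z^*`. -/
def backShift (z : σ.ZIdx → R) (α : Fin σ.n) : R :=
  if h : σ.δ ≤ α then z ⟨α, 0, (mem_shiftMons_of_le h).2 rfl⟩ else 0

theorem translate_X_of_le (z : σ.ZIdx → R) {α : Fin σ.n} (hα : σ.δ ≤ α) :
    σ.translate z (X α) = X α + C (σ.backShift z α) := by
  rw [translate_X, sum_shiftMons_of_le hα, backShift, dif_pos hα]
  rfl

/-- The inverse of the translation of the middle and back variables. -/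
def unshift (z : σ.ZIdx → R) : MvPolynomial (Fin σ.n) R →ₐ[R] MvPolynomial (Fin σ.n) R :=
  aeval fun α => X α - C (σ.backShift z α)

/-- The inverse of `T_z^*`. -/
def untranslate (z : σ.ZIdx → R) : MvPolynomial (Fin σ.n) R →ₐ[R] MvPolynomial (Fin σ.n) R :=
  aeval fun α => if σ.δ ≤ α then X α - C (σ.backShift z α)
    else X α - ∑ m : {m // m ∈ σ.shiftMons α}, σ.unshift z (monomial m.1 (z ⟨α, m⟩))

theorem algHom_monomial_congr {B : Type*} [CommRing B] [Algebra R B]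
    {φ ψ : MvPolynomial (Fin σ.n) R →ₐ[R] B} (h : ∀ α, σ.δ ≤ α → φ (X α) = ψ (X α))
    {m : σ.Mon} (hm : σ.NoFront m) (a : R) : φ (monomial m a) = ψ (monomial m a) := by
  rw [monomial_eq, map_mul, map_mul, ← algebraMap_eq, AlgHom.commutes, AlgHom.commutes,
    Finsupp.prod, map_prod, map_prod]
  congr 1
  refine Finset.prod_congr rfl fun i hi => ?_
  rw [map_pow, map_pow, h]
  by_contra h'
  exact (Finsupp.mem_support_iff.1 hi) (hm i (not_le.1 h'))

theorem noFront_of_mem_shiftMons {α : Fin σ.n} {m : σ.Mon} (hm : m ∈ σ.shiftMons α) :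
    σ.NoFront m := by
  by_cases h : α < σ.δ
  · exact ((mem_shiftMons h).1 hm).2.1
  · rw [(mem_shiftMons_of_le (not_lt.1 h)).1 hm]
    exact low_zero.1

/-- `T_z^*` as an automorphism. -/
def translateEquiv (z : σ.ZIdx → R) : MvPolynomial (Fin σ.n) R ≃ₐ[R] MvPolynomial (Fin σ.n) R :=
  AlgEquiv.ofAlgHom (σ.translate z) (σ.untranslate z)
    (by
      ext1 α
      rw [AlgHom.comp_apply, AlgHom.id_apply, untranslate, aeval_X]
      split_ifs with h
      · rw [map_sub, translate_X_of_le z h, ← algebraMap_eq, AlgHom.commutes, add_sub_cancel_right]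
      · rw [map_sub, translate_X, sub_eq_iff_eq_add, map_sum]
        congr 1
        -- The shift monomials contain no front variable, so undoing the translation of the middle
        -- and back variables is enough to recover them.
        refine Finset.sum_congr rfl fun m _ => ?_
        rw [← AlgHom.comp_apply, ← AlgHom.id_apply (R := R) (monomial m.1 (z ⟨α, m⟩))]
        refine (algHom_monomial_congr (fun β hβ => ?_) (noFront_of_mem_shiftMons m.2) _).symm
        rw [AlgHom.comp_apply, AlgHom.id_apply, unshift, aeval_X, map_sub, translate_X_of_le z hβ,
          ← algebraMap_eq, AlgHom.commutes, add_sub_cancel_right])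
    (by
      ext1 α
      rw [AlgHom.comp_apply, AlgHom.id_apply]
      by_cases h : σ.δ ≤ α
      · rw [translate_X_of_le z h, map_add, untranslate, aeval_X, if_pos h, ← algebraMap_eq,
          AlgHom.commutes, sub_add_cancel]
      · rw [translate_X, map_add, map_sum, untranslate, aeval_X, if_neg h, sub_add_eq_add_sub,
          sub_eq_iff_eq_add]
        congr 1
        refine Finset.sum_congr rfl fun m _ => ?_
        refine algHom_monomial_congr (fun β hβ => ?_) (noFront_of_mem_shiftMons m.2) _
        rw [unshift, aeval_X, aeval_X, if_pos hβ])

theorem map_translateEquiv (z : σ.ZIdx → R) (I : Ideal (MvPolynomial (Fin σ.n) R)) :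
    I.map (translateEquiv z) = I.map (σ.translate z) := by
  rw [Ideal.map, Ideal.map]
  rfl

theorem translate_zero : σ.translate (0 : σ.ZIdx → R) = AlgHom.id R _ := by
  ext1 α
  rw [translate_X]
  simp

end Translation

theorem isHilbPoint_universalIdeal (k : Type*) [Field k] :
    IsHilbPoint σ.n σ.orderIdeal.card (MvPolynomial σ.Idx k) (σ.universalIdeal k) := by
  rw [universalIdeal, ← map_translateEquiv]
  exact (isHilbPoint_modIdeal _ _).map_algEquiv _

/-! ### Compatibility of the constructions with ring homomorphisms -/

section BaseChange

theorem onMons_monomial_smul (φ : σ.Mon → MvPolynomial (Fin σ.n) R) (m : σ.Mon) (a : R) :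
    σ.onMons φ (monomial m a) = a • φ m := by
  rw [← onMons_monomial φ m, ← map_smul, smul_monomial, smul_eq_mul, mul_one]

variable (f : R →+* S)

theorem map_onMons (φ : σ.Mon → MvPolynomial (Fin σ.n) R) (p : MvPolynomial (Fin σ.n) R) :
    MvPolynomial.map f (σ.onMons φ p) =
      σ.onMons (fun m => MvPolynomial.map f (φ m)) (MvPolynomial.map f p) := by
  induction p using MvPolynomial.induction_on' with
  | monomial m a =>
    rw [map_monomial, onMons_monomial_smul, onMons_monomial_smul, smul_eq_C_mul, map_mul, map_C,
      smul_eq_C_mul]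
  | add p q hp hq => simp only [map_add, hp, hq]

theorem map_transport (e : ℕ) (b : σ.Mon) (p : MvPolynomial (Fin σ.n) R) :
    MvPolynomial.map f (σ.transport e b p) = σ.transport e b (MvPolynomial.map f p) := by
  rw [transport, transport, map_divMonomial, map_mul, map_monomial, map_one]

variable (θ : σ.ΘIdx → R) (c : σ.DIdx → R)

theorem map_initTarget : MvPolynomial.map f (σ.initTarget θ) = σ.initTarget (f ∘ θ) := by
  simp only [initTarget, map_sum, map_monomial, Function.comp_apply]

theorem map_targetD (b : σ.Mon) :
    MvPolynomial.map f (σ.targetD θ b) = σ.targetD (f ∘ θ) b := by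
  rw [targetD, targetD, map_onMons, map_transport, map_initTarget]
  congr 2
  funext m
  rw [apply_ite (MvPolynomial.map f), map_monomial, map_one, map_zero]

theorem map_red (p : MvPolynomial (Fin σ.n) R) :
    MvPolynomial.map f (σ.red θ p) = σ.red (f ∘ θ) (MvPolynomial.map f p) := by
  rw [red, red, map_onMons]
  congr 2
  funext m
  rw [apply_ite (MvPolynomial.map f), apply_ite (MvPolynomial.map f), map_monomial, map_one,
    map_zero, map_neg, map_targetD]

theorem map_topTarget (i : ℕ) :
    MvPolynomial.map f (σ.topTarget θ i) = σ.topTarget (f ∘ θ) i := by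
  induction i with
  | zero => exact map_initTarget f θ
  | succ i ih => rw [topTarget, topTarget, map_divMonomial, map_red, map_mul, map_X, ih]

theorem map_target (b : σ.Mon) :
    MvPolynomial.map f (σ.target θ b) = σ.target (f ∘ θ) b := by
  rw [target, target]
  split_ifs
  · exact map_targetD f θ b
  · rw [map_transport, map_topTarget]
  · exact map_zero _

theorem map_trail (b : σ.Mon) : MvPolynomial.map f (σ.trail c b) = σ.trail (f ∘ c) b := by
  rw [trail, trail]
  split_ifs
  · simp only [map_sum, map_monomial, Function.comp_apply]
  · exact map_zero _

theorem map_modGen (b : σ.Mon) :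
    MvPolynomial.map f (σ.modGen c θ b) = σ.modGen (f ∘ c) (f ∘ θ) b := by
  rw [modGen_eq, modGen_eq, map_add, map_sub, map_monomial, map_one, map_trail, map_target]

theorem map_modIdeal :
    (σ.modIdeal c θ).map (MvPolynomial.map f) = σ.modIdeal (f ∘ c) (f ∘ θ) := by
  rw [modIdeal, modIdeal, Ideal.map_span, Set.image_image]
  simp only [map_modGen]

theorem map_translate (z : σ.ZIdx → R) (p : MvPolynomial (Fin σ.n) R) :
    MvPolynomial.map f (σ.translate z p) = σ.translate (f ∘ z) (MvPolynomial.map f p) := by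
  induction p using MvPolynomial.induction_on with
  | C a => rw [map_C, ← algebraMap_eq, ← algebraMap_eq, AlgHom.commutes, AlgHom.commutes,
      algebraMap_eq, map_C]; rfl
  | add p q hp hq => simp only [map_add, hp, hq]
  | mul_X p i ih =>
    simp only [map_mul, ih, map_X, translate_X, map_add, map_sum, map_monomial,
      Function.comp_apply]

end BaseChange

/-- At a point with `z = 0`, the family of ideals specializes to the mod-distinguished ideal. -/
theorem universalIdeal_map_eval {k : Type*} [Field k] (p : σ.Idx → k)
    (hp : ∀ ζ : σ.ZIdx, p (Sum.inr (Sum.inr ζ)) = 0) :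
    (σ.universalIdeal k).map (MvPolynomial.map (eval p)) =
      σ.modIdeal (fun i => p (Sum.inl i)) (fun q => p (Sum.inr (Sum.inl q))) := by
  have h : (MvPolynomial.map (eval p)).comp
      (σ.translate fun ζ => (X (Sum.inr (Sum.inr ζ)) : MvPolynomial σ.Idx k)).toRingHom =
      MvPolynomial.map (eval p) := by
    refine RingHom.ext fun q => ?_
    have h0 : eval p ∘ (fun ζ : σ.ZIdx => (X (Sum.inr (Sum.inr ζ)) : MvPolynomial σ.Idx k)) = 0 :=
      funext fun ζ => by simp [hp]
    have := map_translate (σ := σ) (eval p) (fun ζ => X (Sum.inr (Sum.inr ζ))) q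
    rw [h0, translate_zero] at this
    exact this
  have h2 := Ideal.map_map (I := σ.modIdeal (fun i => (X (Sum.inl i) : MvPolynomial σ.Idx k))
    (fun q => X (Sum.inr (Sum.inl q))))
    (σ.translate fun ζ => (X (Sum.inr (Sum.inr ζ)) : MvPolynomial σ.Idx k)).toRingHom
    (MvPolynomial.map (eval p))
  rw [h, map_modIdeal] at h2
  refine h2.trans ?_
  congr 1 <;> funext i <;> simp

end Signature

/-! ### Arithmetic in k[ε][x] and the tangent map -/

namespace HilbPoint

variable {n μ : ℕ} {k : Type*} [Field k]

theorem join_mul (f g f' g' : MvPolynomial (Fin n) k) :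
    join f g * join f' g' = join (f * f') (f * g' + f' * g) := by
  have h : (MvPolynomial.C DualNumber.eps : MvPolynomial (Fin n) (DualNumber k)) *
      MvPolynomial.C DualNumber.eps = 0 := by
    rw [← map_mul, DualNumber.eps_mul_eps, map_zero]
  simp only [join, map_mul, map_add]
  linear_combination MvPolynomial.map (inlHom k k) g * MvPolynomial.map (inlHom k k) g' * h

theorem join_monomial (m : Fin n →₀ ℕ) (a : DualNumber k) :
    join (monomial m a.fst) (monomial m a.snd) = monomial m a := by
  ext1 m'
  rw [coeff_join, coeff_monomial, coeff_monomial, coeff_monomial]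
  split_ifs
  · exact inl_fst_add_inr_snd_eq a
  · simp

theorem split_monomial_snd (m : Fin n →₀ ℕ) (a : DualNumber k) :
    (split n k (monomial m a)).snd = monomial m a.snd := by
  rw [← join_monomial, split_join]
  simp

theorem join_sum {κ : Type*} (s : Finset κ) (f g : κ → MvPolynomial (Fin n) k) :
    join (∑ i ∈ s, f i) (∑ i ∈ s, g i) = ∑ i ∈ s, join (f i) (g i) := by
  simp only [join, map_sum, Finset.mul_sum, Finset.sum_add_distrib]

theorem Tangent.toHom_zero (x : HilbPoint n μ k) : (0 : Tangent x).toHom = 0 := by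
  have := Tangent.toHom_add (0 : Tangent x) 0
  rwa [add_zero, left_eq_add] at this

theorem linearIndependent_coordTangent {ι : Type*} [Finite ι]
    (F : HilbPoint n μ (MvPolynomial ι k)) {p : ι → k}
    (h : Function.Injective (tangentMap F p)) : LinearIndependent k (coordTangent F p) := by
  have h1 : coordTangent F p = tangentMap F p ∘ Pi.basisFun k ι := by
    funext χ
    rw [coordTangent, Function.comp_apply, Pi.basisFun_apply]
  rw [h1]
  exact (Pi.basisFun k ι).linearIndependent.map' (tangentMap F p) (LinearMap.ker_eq_bot.2 h)

end HilbPoint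

open HilbPoint

namespace Signature

variable {σ : Signature} {k : Type*} [Field k]

/-! ### The vector field of an infinitesimal T*_Z -/

section Derivation

variable (ζ : σ.ZIdx → k)

/-- The first-order variation of `x_α` under `T_z^*`. -/
def shiftPoly (α : Fin σ.n) : MvPolynomial (Fin σ.n) k :=
  ∑ m : {m // m ∈ σ.shiftMons α}, monomial m.1 (ζ ⟨α, m⟩)

/-- The vector field generating the first-order variation of `T_z^*`. -/
def shiftDer : Derivation k (MvPolynomial (Fin σ.n) k) (MvPolynomial (Fin σ.n) k) :=
  mkDerivation k (σ.shiftPoly ζ)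

theorem shiftPoly_of_le {α : Fin σ.n} (hα : σ.δ ≤ α) :
    σ.shiftPoly ζ α = C (ζ ⟨α, 0, (mem_shiftMons_of_le hα).2 rfl⟩) := by
  rw [shiftPoly, sum_shiftMons_of_le hα]
  rfl

theorem coeff_shiftPoly {α : Fin σ.n} (m : {m // m ∈ σ.shiftMons α}) :
    (σ.shiftPoly ζ α).coeff m.1 = ζ ⟨α, m⟩ := by
  rw [shiftPoly, coeff_sum, Finset.sum_eq_single_of_mem m (Finset.mem_univ _)]
  · rw [coeff_monomial, if_pos rfl]
  · intro m' _ h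
    rw [coeff_monomial, if_neg fun h' => h (Subtype.ext h')]

/-- First-order Taylor expansion: with shift parameters εζ, the product rule modulo ε² produces the
derivation with x_α ↦ ∑ ζ_{α,m} m, and the ε-part g is unaffected since ε² = 0. -/
theorem translate_inr_join (f g : MvPolynomial (Fin σ.n) k) :
    σ.translate (fun i => (inr (ζ i) : DualNumber k)) (join f g) =
      join f (g + σ.shiftDer ζ f) := by
  have h0 : ∀ f : MvPolynomial (Fin σ.n) k,
      σ.translate (fun i => (inr (ζ i) : DualNumber k)) (MvPolynomial.map (inlHom k k) f) =
        join f (σ.shiftDer ζ f) := by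
    intro f
    induction f using MvPolynomial.induction_on with
    | C a =>
      rw [map_C, ← algebraMap_eq, AlgHom.commutes, ← algebraMap_eq (R := k),
        Derivation.map_algebraMap]
      simp [join]
    | add p q hp hq => rw [map_add, map_add, map_add, hp, hq, join_add]
    | mul_X p i ih =>
      rw [map_mul, map_mul, ih, map_X, translate_X, Derivation.leibniz, shiftDer, mkDerivation_X,
        smul_eq_mul, smul_eq_mul, ← shiftDer, ← join_mul]
      congr 1
      have h1 : ∀ m : {m // m ∈ σ.shiftMons i},
          (monomial m.1 (inr (ζ ⟨i, m⟩)) : MvPolynomial (Fin σ.n) (DualNumber k)) =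
            join 0 (monomial m.1 (ζ ⟨i, m⟩)) := fun m => by
        rw [← join_monomial]
        simp
      have h2 : (X i : MvPolynomial (Fin σ.n) (DualNumber k)) = join (X i) 0 := by simp [join]
      rw [Finset.sum_congr rfl fun m _ => h1 m, ← join_sum, h2, join_add]
      simp [shiftPoly]
  have h1 : (MvPolynomial.C DualNumber.eps : MvPolynomial (Fin σ.n) (DualNumber k)) =
      join 0 1 := by simp [join]
  conv_lhs => rw [join]
  rw [map_add, map_mul, h0, h0, ← algebraMap_eq, AlgHom.commutes, algebraMap_eq, h1, join_mul,
    join_add]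
  congr 1
  · ring
  · ring

/-- Used once some shifts are known to vanish: only the direction α still contributes on p. -/
theorem shiftDer_eq_mul_pderiv {α : Fin σ.n} {p : MvPolynomial (Fin σ.n) k}
    (hp : p ∈ restrictSupport k {m : σ.Mon | ∀ i, i ≠ α → m i ≠ 0 → σ.shiftPoly ζ i = 0}) :
    σ.shiftDer ζ p = σ.shiftPoly ζ α * pderiv α p := by
  have := derivation_eq_of_forall_mem_vars (D₁ := σ.shiftDer ζ)
    (D₂ := σ.shiftPoly ζ α • pderiv α) (f := p) fun i hi => ?_
  · rw [this, Derivation.smul_apply, smul_eq_mul]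
  · obtain ⟨m, hm, hi⟩ := (mem_vars_iff_mem_support i).1 hi
    rw [Derivation.smul_apply, shiftDer, mkDerivation_X]
    by_cases h : i = α
    · subst h
      simp
    · rw [pderiv_X_of_ne h, smul_zero]
      exact hp hm i h (Finsupp.mem_support_iff.1 hi)

end Derivation

/-! ### First-order variation of the generators -/

section Tangent

variable (c u : σ.DIdx → k) (θ τ : σ.ΘIdx → k) (ζ : σ.ZIdx → k)

/-- The derivative of `θ ↦ Υ(b)` at `θ` in the direction `τ`. -/
def targetDer (b : σ.Mon) : MvPolynomial (Fin σ.n) k :=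
  (split σ.n k (σ.target (fun q => (inl (θ q) + inr (τ q) : DualNumber k)) b)).snd

/-- The support bound for Υ holds over every ring, so over k[ε] it bounds the ε-part as well. -/
theorem targetDer_mem (b : σ.Mon) : σ.targetDer θ τ b ∈
    restrictSupport k {m : σ.Mon | σ.Low m ∧ σ.r ≤ m.degree ∧ m.degree ≤ σ.s} := by
  refine mem_restrictSupport_of_coeff fun m hm => ?_
  rw [targetDer, coeff_split_snd, coeff_eq_zero_of_mem_restrictSupport (target_mem _ b) hm,
    snd_zero]

theorem targetDer_segTop : σ.targetDer θ τ (σ.segTop σ.w) = σ.initTarget τ := by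
  rw [targetDer, target_segTop, initTarget, map_sum, snd_sum, initTarget]
  refine Finset.sum_congr rfl fun q _ => ?_
  rw [split_monomial_snd]
  simp

theorem targetDer_zero (b : σ.Mon) : σ.targetDer θ 0 b = 0 := by
  have : (fun q => (inl (θ q) + inr ((0 : σ.ΘIdx → k) q) : DualNumber k)) = inlHom k k ∘ θ := by
    funext q
    simp
  rw [targetDer, this, ← map_target, split_map, snd_inl]

theorem targetDer_of_not {b : σ.Mon} (h : ¬ σ.InSD b) (h' : ¬ σ.InSL b) :
    σ.targetDer θ τ b = 0 := by
  rw [targetDer, target_of_not _ h h', map_zero, snd_zero]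

/-- The first-order variation of the generator `T_z^*(Ĝ_b)` at `z = 0` in the direction
`(u, τ, ζ)`. -/
def genDer (b : σ.Mon) : MvPolynomial (Fin σ.n) k :=
  σ.targetDer θ τ b - σ.trail u b + σ.shiftDer ζ (σ.modGen c θ b)

theorem translate_modGen_eq (b : σ.Mon) :
    σ.translate (fun i => (inr (ζ i) : DualNumber k))
      (σ.modGen (fun i => inl (c i) + inr (u i)) (fun q => inl (θ q) + inr (τ q)) b) =
    join (σ.modGen c θ b) (σ.genDer c u θ τ ζ b) := by
  set G := σ.modGen (fun i => (inl (c i) + inr (u i) : DualNumber k))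
    (fun q => inl (θ q) + inr (τ q)) b with hG
  have h1 : (split σ.n k G).fst = σ.modGen c θ b := by
    rw [← map_epsZero, hG, map_modGen]
    congr 1
    · funext i; simp [epsZero]
    · funext i; simp [epsZero]
  have h2 : (split σ.n k G).snd = σ.targetDer θ τ b - σ.trail u b := by
    have h3 : (split σ.n k (σ.trail (fun i => (inl (c i) + inr (u i) : DualNumber k)) b)).snd =
        σ.trail u b := by
      rw [trail, trail]
      split_ifs
      · rw [map_sum, snd_sum]
        refine Finset.sum_congr rfl fun q _ => ?_
        rw [split_monomial_snd]
        simp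
      · rw [map_zero, snd_zero]
    rw [hG, modGen_eq, map_add, map_sub, snd_add, snd_sub, h3, split_monomial_snd, ← targetDer]
    simp only [snd_one, map_zero]
    ring
  rw [← join_split G, h1, h2, translate_inr_join, genDer]

end Tangent

/-- The tangent vector corresponds to a homomorphism I → k[x]/I that sends Ĝ_b to the class of its
first-order variation. For the zero vector that class is zero. -/
theorem genDer_mem_of_tangentMap_eq_zero
    (hF : IsHilbPoint σ.n σ.orderIdeal.card (MvPolynomial σ.Idx k) (σ.universalIdeal k))
    {p v : σ.Idx → k} (hp : ∀ ζ : σ.ZIdx, p (Sum.inr (Sum.inr ζ)) = 0)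
    (hv : tangentMap ⟨σ.universalIdeal k, hF⟩ p v = 0) {b : σ.Mon} (hb : b ∈ σ.border) :
    σ.genDer (fun i => p (Sum.inl i)) (fun i => v (Sum.inl i)) (fun q => p (Sum.inr (Sum.inl q)))
      (fun q => v (Sum.inr (Sum.inl q))) (fun ζ => v (Sum.inr (Sum.inr ζ))) b ∈
    σ.modIdeal (fun i => p (Sum.inl i)) (fun q => p (Sum.inr (Sum.inl q))) := by
  set F : HilbPoint σ.n σ.orderIdeal.card (MvPolynomial σ.Idx k) := ⟨σ.universalIdeal k, hF⟩
  have hI : (F.map (eval p)).ideal =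
      σ.modIdeal (fun i => p (Sum.inl i)) (fun q => p (Sum.inr (Sum.inl q))) :=
    universalIdeal_map_eval p hp
  have h1 : σ.modGen (fun i => p (Sum.inl i)) (fun q => p (Sum.inr (Sum.inl q))) b ∈
      (F.map (eval p)).ideal := by
    rw [hI]
    exact Ideal.subset_span ⟨b, hb, rfl⟩
  have h2 : σ.translate (fun ζ => (X (Sum.inr (Sum.inr ζ)) : MvPolynomial σ.Idx k))
      (σ.modGen (fun i => X (Sum.inl i)) (fun q => X (Sum.inr (Sum.inl q))) b) ∈ F.ideal :=
    Ideal.mem_map_of_mem _ (Ideal.subset_span ⟨b, hb, rfl⟩)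
  have h3 := Ideal.mem_map_of_mem (MvPolynomial.map (tangentPoint p v)) h2
  rw [map_translate, map_modGen] at h3
  have h4 : tangentPoint p v ∘ (fun ζ : σ.ZIdx => X (Sum.inr (Sum.inr ζ))) =
      fun ζ => inr (v (Sum.inr (Sum.inr ζ))) := by
    funext ζ
    simp [tangentPoint, hp]
  have h5 : tangentPoint p v ∘ (fun i : σ.DIdx => X (Sum.inl i)) =
      fun i => inl (p (Sum.inl i)) + inr (v (Sum.inl i)) := by
    funext i
    simp [tangentPoint]
  have h6 : tangentPoint p v ∘ (fun q : σ.ΘIdx => X (Sum.inr (Sum.inl q))) =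
      fun q => inl (p (Sum.inr (Sum.inl q))) + inr (v (Sum.inr (Sum.inl q))) := by
    funext q
    simp [tangentPoint]
  rw [h4, h5, h6, translate_modGen_eq] at h3
  have h7 := ((tangentMap F p v).toHom_eq_iff ⟨_, h1⟩ _).2 h3
  rw [hv, Tangent.toHom_zero, LinearMap.zero_apply, eq_comm, Ideal.Quotient.eq_zero_iff_mem,
    hI] at h7
  exact h7

/-! ### Injectivity: testing the variation on chosen border monomials -/

section Injectivity

variable {c u : σ.DIdx → k} {θ τ : σ.ΘIdx → k} {ζ : σ.ZIdx → k}

theorem modGen_mem_noFront {b : σ.Mon} (hb : σ.NoFront b) :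
    σ.modGen c θ b ∈ restrictSupport k {m : σ.Mon | σ.NoFront m} := by
  rw [modGen_eq]
  refine add_mem (sub_mem ((monomial_mem_restrictSupport k).2 (Or.inl hb)) ?_) ?_
  · exact restrictSupport_mono k (fun _ h => h.1.1) (trail_mem c b)
  · exact restrictSupport_mono k (fun _ h => h.1.1) (target_mem θ b)

theorem shiftPoly_eq_zero_of_back [CharZero k]
    (H : ∀ b ∈ σ.border, σ.genDer c u θ τ ζ b ∈ σ.modIdeal c θ) {α : Fin σ.n} (hα : σ.δ < α) :
    σ.shiftPoly ζ α = 0 := by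
  have hs := σ.r_lt_s
  have hlow : ∀ a, σ.Low (Finsupp.single α a) := fun a => by
    simpa using low_single_add hα low_zero a
  -- For x_α^{s+1} there are no trailing terms and no target, so the variation is (s+1) ζ_α x_α^s, a
  -- multiple of a monomial of 𝒪.
  set b : σ.Mon := Finsupp.single α (σ.s + 1) with hb
  have hd : b.degree = σ.s + 1 := Finsupp.degree_single _ _
  have hbb : b ∈ σ.border := by
    refine ⟨fun h => ?_, Finsupp.single α σ.s, mem_orderIdeal.2 (Or.inr ⟨?_, hlow _⟩), α, ?_⟩
    · rw [mem_orderIdeal] at h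
      omega
    · rw [Finsupp.degree_single]
    · rw [hb, Finsupp.single_add]
  have h1 : b ∉ σ.leadMons := fun h => by have := (mem_leadMons.1 h).1; omega
  have h2 : ¬ σ.InSD b := fun h => by have := h.2.2.2; omega
  have h3 : ¬ σ.InSL b := fun h => h1 h.1
  have h4 : pderiv α (monomial b (1 : k)) = monomial (Finsupp.single α σ.s) ((σ.s : k) + 1) := by
    rw [pderiv_monomial, hb]
    simp
  have h5 := H b hbb
  rw [genDer, targetDer_of_not θ τ h2 h3, trail_of_notMem u h1, modGen_eq, trail_of_notMem c h1,
    target_of_not θ h2 h3, sub_zero, sub_zero, add_zero, zero_add,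
    shiftDer_eq_mul_pderiv (α := α), h4, shiftPoly_of_le ζ hα.le, C_mul_monomial] at h5
  · have h6 := eq_zero_of_mem_modIdeal c θ h5 ((monomial_mem_restrictSupport k).2 (Or.inl
      (mem_orderIdeal.2 (Or.inr ⟨by rw [Finsupp.degree_single], hlow _⟩))))
    rw [monomial_eq_zero] at h6
    rw [shiftPoly_of_le ζ hα.le, (mul_eq_zero.1 h6).resolve_right (Nat.cast_add_one_ne_zero _),
      map_zero]
  · refine (monomial_mem_restrictSupport k).2 (Or.inl fun i hi h => ?_)
    simp [hb, hi.symm] at h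

theorem shiftDer_of_noFront (hζ : ∀ α, σ.δ < α → σ.shiftPoly ζ α = 0)
    {p : MvPolynomial (Fin σ.n) k} (hp : p ∈ restrictSupport k {m : σ.Mon | σ.NoFront m}) :
    σ.shiftDer ζ p = σ.shiftPoly ζ σ.δ * pderiv σ.δ p := by
  refine shiftDer_eq_mul_pderiv ζ (restrictSupport_mono k (fun m hm i hi h => ?_) hp)
  rcases hi.lt_or_gt with h' | h'
  · exact absurd (hm i h') h
  · exact hζ i h'

theorem shiftPoly_eq_zero_of_le [CharZero k]
    (H : ∀ b ∈ σ.border, σ.genDer c u θ τ ζ b ∈ σ.modIdeal c θ) {α : Fin σ.n} (hα : σ.δ ≤ α) :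
    σ.shiftPoly ζ α = 0 := by
  have hback : ∀ α, σ.δ < α → σ.shiftPoly ζ α = 0 := fun α => shiftPoly_eq_zero_of_back H
  rcases hα.lt_or_eq with hα | rfl
  · exact hback α hα
  have hr := σ.two_le_r
  have hs := σ.r_lt_s
  set b : σ.Mon := Finsupp.single σ.δ σ.r with hb
  have hd : b.degree = σ.r := Finsupp.degree_single _ _
  have hnl : ¬ σ.Low b := fun h => by have := h.2; simp [hb] at this; omega
  have hnf : σ.NoFront b := noFront_single le_rfl _
  -- For b = x_δ^r the coefficient of x_δ^{r-1} in the variation is r ζ_δ: the targets and trailing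
  -- terms are low, so they miss x_δ^r, and the variations of their coefficients live in degree at
  -- least r. Elements of I have no term of degree r-1.
  have h5 := coeff_eq_zero_of_mem_restrictSupport
    (mem_ordGe_of_mem_modIdeal c θ (H b (mem_border_of_degree hd hnl)))
    (m := Finsupp.single σ.δ (σ.r - 1)) (fun h => by
      have : σ.r ≤ (Finsupp.single σ.δ (σ.r - 1) : σ.Mon).degree := h
      rw [Finsupp.degree_single] at this
      omega)
  have h6 : (Finsupp.single σ.δ (σ.r - 1) + Finsupp.single σ.δ 1 : σ.Mon) = b := by
    rw [← Finsupp.single_add, hb, Nat.sub_add_cancel (by omega)]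
  rw [genDer, shiftDer_of_noFront hback (modGen_mem_noFront hnf), coeff_add, coeff_sub,
    coeff_eq_zero_of_mem_restrictSupport (targetDer_mem θ τ b),
    coeff_eq_zero_of_mem_restrictSupport (trail_mem u b), shiftPoly_of_le ζ le_rfl, coeff_C_mul,
    coeff_pderiv, h6, modGen_eq, coeff_add, coeff_sub,
    coeff_eq_zero_of_mem_restrictSupport (target_mem θ b) (fun h => hnl h.1),
    coeff_eq_zero_of_mem_restrictSupport (trail_mem c b) (fun h => hnl h.1), coeff_monomial,
    if_pos rfl] at h5
  · have h7 : ((σ.r - 1 : ℕ) : k) + 1 ≠ 0 := Nat.cast_add_one_ne_zero _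
    rw [shiftPoly_of_le ζ le_rfl]
    simpa [h7] using h5
  · rintro ⟨-, h⟩
    rw [Finsupp.degree_single] at h
    omega
  · rintro ⟨-, h, -⟩
    rw [Finsupp.degree_single] at h
    omega

theorem shiftPoly_eq_zero [CharZero k]
    (H : ∀ b ∈ σ.border, σ.genDer c u θ τ ζ b ∈ σ.modIdeal c θ) (α : Fin σ.n) :
    σ.shiftPoly ζ α = 0 := by
  have hge : ∀ α, σ.δ ≤ α → σ.shiftPoly ζ α = 0 := fun α => shiftPoly_eq_zero_of_le H
  rcases le_or_gt σ.δ α with hα | hα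
  · exact hge α hα
  have hr := σ.two_le_r
  have hs := σ.r_lt_s
  have hne : σ.last ≠ α := (hα.trans δ_lt_last).ne'
  -- The front variable removes the target. As the shift of x_n is already zero, D(b) is x_n^{r-1}
  -- times the shift of x_α, and the factor x_n^{r-1} gives b degree exactly r.
  set b : σ.Mon := Finsupp.single σ.last (σ.r - 1) + Finsupp.single α 1 with hb
  have hd : b.degree = σ.r := by
    rw [hb, map_add, Finsupp.degree_single, Finsupp.degree_single]
    omega
  have hnf : ¬ σ.NoFront b := fun h => not_noFront_single hα one_ne_zero (noFront_add.1 h).2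
  have hnl : ¬ σ.Low b := fun h => hnf h.1
  have hbb : b ∈ σ.border := mem_border_of_degree hd hnl
  have h1 : σ.shiftDer ζ (σ.trail c b) = 0 := by
    rw [shiftDer_of_noFront (fun α h => hge α h.le)
      (restrictSupport_mono k (fun _ h => h.1.1) (trail_mem c b)), hge _ le_rfl, zero_mul]
  have h2 : σ.shiftDer ζ (monomial b 1) =
      monomial (Finsupp.single σ.last (σ.r - 1)) 1 * σ.shiftPoly ζ α := by
    rw [shiftDer_eq_mul_pderiv (α := α), pderiv_monomial, mul_comm]
    · congr 2
      · rw [hb, add_tsub_cancel_right]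
      · simp [hb, hne]
    · refine (monomial_mem_restrictSupport k).2 (Or.inl fun i hi h => ?_)
      by_cases h' : i = σ.last
      · exact h' ▸ hge _ δ_lt_last.le
      · simp [hb, hi.symm, Ne.symm h'] at h
  have h3 := H b hbb
  rw [genDer, targetDer_of_not θ τ (fun h => hnf h.2.1) (fun h => hnf h.2), modGen_eq,
    target_of_not_noFront θ hnf, add_zero, map_sub, h1, sub_zero, h2, zero_sub,
    neg_add_eq_sub] at h3
  have hmem : monomial (Finsupp.single σ.last (σ.r - 1)) 1 * σ.shiftPoly ζ α ∈
      restrictSupport k {m : σ.Mon | σ.Low m ∧ m.degree < σ.s} := by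
    refine monomial_mul_mem_restrictSupport (S := {m : σ.Mon | m ∈ σ.shiftMons α}) 1 ?_
      (Submodule.sum_mem _ fun m _ => (monomial_mem_restrictSupport k).2 (Or.inl m.2))
    intro m hm
    obtain ⟨h4, h5⟩ := (mem_shiftMons hα).1 hm
    refine ⟨low_single_add δ_lt_last h5 _, ?_⟩
    rw [map_add, Finsupp.degree_single]
    omega
  have h4 := eq_zero_of_mem_modIdeal c θ h3 (sub_mem
    (restrictSupport_mono k (fun _ h => mem_orderIdeal.2 (Or.inr ⟨h.2.le, h.1⟩)) hmem)
    (trail_mem_orderSpan u b))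
  rw [sub_eq_zero] at h4
  -- A polynomial of degree below s equals one homogeneous of degree s; both vanish.
  have h5 : monomial (Finsupp.single σ.last (σ.r - 1)) 1 * σ.shiftPoly ζ α = 0 := by
    ext m
    rw [coeff_zero]
    by_cases hm : m.degree < σ.s
    · rw [h4]
      exact coeff_eq_zero_of_mem_restrictSupport (trail_mem u b) fun h => hm.ne h.2
    · exact coeff_eq_zero_of_mem_restrictSupport hmem fun h => hm h.2
  refine (mul_eq_zero.1 h5).resolve_left ?_
  rw [monomial_eq_zero]
  exact one_ne_zero

theorem eq_zero_of_genDer_mem [CharZero k]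
    (H : ∀ b ∈ σ.border, σ.genDer c u θ τ ζ b ∈ σ.modIdeal c θ) :
    u = 0 ∧ τ = 0 ∧ ζ = 0 := by
  have hw := σ.w_lt_r
  have hζ := shiftPoly_eq_zero H
  have hD : ∀ p, σ.shiftDer ζ p = 0 := fun p =>
    derivation_eq_zero_of_forall_mem_vars fun i _ => by rw [shiftDer, mkDerivation_X, hζ]
  -- With all shifts zero, the variation is supported on 𝒪, so membership in I makes it vanish
  -- identically.
  have H' : ∀ b ∈ σ.border, σ.targetDer θ τ b = σ.trail u b := fun b hb => by
    have h1 := H b hb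
    rw [genDer, hD, add_zero] at h1
    refine sub_eq_zero.1 (eq_zero_of_mem_modIdeal c θ h1 (sub_mem ?_ (trail_mem_orderSpan u b)))
    exact restrictSupport_mono k (fun _ h => mem_orderIdeal.2 (Or.inr ⟨h.2.2, h.1⟩))
      (targetDer_mem θ τ b)
  have hτ : τ = 0 := by
    funext q
    have hd : (σ.segTop σ.w).degree = σ.r := degree_segTop hw.le
    -- At b_w the target is linear in θ with the θ_q as its coefficients; the monomials involved
    -- have degree below s and so miss the trailing ones.
    have h1 := congrArg (coeff q.1) (H' (σ.segTop σ.w) (mem_border_of_degree hd fun h => by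
      have := h.2
      rw [segTop_δ] at this
      omega))
    rw [targetDer_segTop, coeff_eq_zero_of_mem_restrictSupport (trail_mem u _)
        fun h => (mem_tar''.1 q.2).1.2.1.ne h.2, initTarget, coeff_sum,
      Finset.sum_eq_single_of_mem q (Finset.mem_univ _), coeff_monomial, if_pos rfl] at h1
    · exact h1
    · intro q' _ h
      rw [coeff_monomial, if_neg fun h' => h (Subtype.ext h')]
  subst hτ
  refine ⟨?_, rfl, ?_⟩
  · funext ⟨⟨b, hb⟩, t⟩
    obtain ⟨h1, h2⟩ := mem_leadMons.1 hb
    have h3 := congrArg (coeff t.1) (H' b (mem_border_of_degree h1 h2))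
    rw [targetDer_zero, trail, dif_pos hb, coeff_zero, coeff_sum,
      Finset.sum_eq_single_of_mem t (Finset.mem_univ _), coeff_monomial, if_pos rfl] at h3
    · exact h3.symm
    · intro t' _ h
      rw [coeff_monomial, if_neg fun h' => h (Subtype.ext h')]
  · funext ⟨α, m⟩
    rw [← coeff_shiftPoly ζ m, hζ, coeff_zero, Pi.zero_apply]

theorem tangentMap_injective [CharZero k]
    (hF : IsHilbPoint σ.n σ.orderIdeal.card (MvPolynomial σ.Idx k) (σ.universalIdeal k))
    {p : σ.Idx → k} (hp : ∀ ζ : σ.ZIdx, p (Sum.inr (Sum.inr ζ)) = 0) :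
    Function.Injective (tangentMap ⟨σ.universalIdeal k, hF⟩ p) := by
  rw [injective_iff_map_eq_zero]
  intro v hv
  obtain ⟨h1, h2, h3⟩ :=
    eq_zero_of_genDer_mem fun b hb => genDer_mem_of_tangentMap_eq_zero hF hp hv hb
  funext χ
  rcases χ with i | q | i
  · exact congrFun h1 i
  · exact congrFun h2 q
  · exact congrFun h3 i

end Injectivity

end Signature

end

theorem mainTheorem3 {k : Type*} [Field k] [IsAlgClosed k] [CharZero k] (σ : Signature) :
    ∃ hF : IsHilbPoint σ.n σ.orderIdeal.card (MvPolynomial σ.Idx k) (σ.universalIdeal k),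
      ∀ p : σ.Idx → k, (∀ ζ : σ.ZIdx, p (Sum.inr (Sum.inr ζ)) = 0) →
        LinearIndependent k (fun χ : σ.Idx =>
          HilbPoint.coordTangent ⟨σ.universalIdeal k, hF⟩ p χ) ∧
        Function.Injective (HilbPoint.tangentMap ⟨σ.universalIdeal k, hF⟩ p) :=
  ⟨Signature.isHilbPoint_universalIdeal k, fun _ hp =>
    have h := Signature.tangentMap_injective _ hp
    ⟨HilbPoint.linearIndependent_coordTangent _ h, h⟩⟩
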